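/- For $i=1,2$, let $G_i$ be a stratified nilpotent Lie group: its Lie algebra is finite-dimensional and real and is a direct sum $\mathfrak v_1\oplus\dots\oplus\mathfrak v_k$ with $[\mathfrak v_1,\mathfrak v_j]=\mathfrak v_{j+1}$ for $1\le j\le k$, where $\mathfrak v_{k+1}=\{0\}$, and $G_i$ is identified with its Lie algebra by the exponential map (so the product is given by the Baker–Campbell–Hausdorff formula, and Haar measure is Lebesgue measure). Let $Q_i=\sum_j j\dim\mathfrak v_j$ be the homogeneous dimension and let $\delta_t(X_1+\dots+X_k)=tX_1+\dots+t^kX_k$ be the dilations. Let $\rho_i:G_i\to[0,\infty)$ be a continuous homogeneous norm: $\rho_i(g^{-1})=\rho_i(g)$, $\rho_i(gh)\le\rho_i(g)+\rho_i(h)$, $\rho_i(\delta_t g)=t\rho_i(g)$ for $t>0$, and $\rho_i(g)=0$ only at the identity $o$. Put $\rho_i(g,h)=\rho_i(g^{-1}h)$ and $B_i(g,r)=\{h:\rho_i(g,h)<r\}$. Fix $\varepsilon\in(0,1]$, and let $\psi^{[i]}:G_i\to\mathbb C$ satisfy, for some constant $C$ and all $g,g'\in G_i$, $$|\psi^{[i]}(g)|\le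 \frac{C}{(1+\rho_i(g))^{Q_i+\varepsilon}},\qquad |\psi^{[i]}(g)-\psi^{[i]}(g')|\le \frac{C\,\rho_i(g,g')^{\varepsilon}}{(1+\rho_i(g)+\rho_i(g'))^{Q_i+2\varepsilon}},\qquad \int_{G_i}\psi^{[i]}=0 .$$ Write $\psi^{[i]}_t=t^{-Q_i}\psi^{[i]}\circ\delta_{1/t}$ and $\psi_{t_1,t_2}=\psi^{[1]}_{t_1}\otimes\psi^{[2]}_{t_2}$. For $f\in L^1(G_1\times G_2)$ and $\beta>0$ define $$S_{\psi,\beta}(f)(g_1,g_2)=\left(\iint_{\Gamma^\beta(g_1,g_2)}\frac{|f*\psi_{t_1,t_2}(h_1,h_2)|^2}{|B_1(o,\beta t_1)\times B_2(o,\beta t_2)|}\,dh_1\,dh_2\,\frac{dt_1\,dt_2}{t_1t_2}\right)^{1/2},$$ where $\Gamma^\beta(g_1,g_2)=\{(h_1,h_2,t_1,t_2): t_i>0,\ \rho_i(g_i,h_i)\le\beta t_i,\ i=1,2\}$ and $(f*\phi)(g)=\int f(h)\phi(h^{-1}g)\,dh$. Let $H^1_{sq,\psi,\beta}(G_1\times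 G_2)$ be the space of all $f\in L^1(G_1\times G_2)$ such that $\|S_{\psi,\beta}(f)\|_{L^1}<\infty$, with norm $\|S_{\psi,\beta}(f)\|_{L^1}$. Then, for every $\beta>0$, $$H^1_{sq,\psi,\beta}(G_1\times G_2)=H^1_{sq,\psi,1}(G_1\times G_2),$$ and the norms are equivalent: there are constants $c,C>0$, which may depend on $\beta$ but not on $\psi$ or $f$, such that $c\,\|S_{\psi,1}(f)\|_{L^1}\le\|S_{\psi,\beta}(f)\|_{L^1}\le C\,\|S_{\psi,1}(f)\|_{L^1}$ for all $f\in L^1(G_1\times G_2)$. Moreover, there is a constant $C>0$, independent of $\beta$, $\psi$ and $f$, such that for all $\beta\ge1$ and all $f\in L^1(G_1\times G_2)$ $$\|S_{\psi,\beta}(f)\|_{L^1}\le C\,\beta^{Q_1+Q_2}(1+\log^+\beta)\,\|S_{\psi,1}(f)\|_{L^1}.$$ -/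

import Mathlib

open MeasureTheory Set
open scoped ENNReal

/-!
# Area functions on products of stratified groups

A stratified group is identified with its Lie algebra through the exponential map. So the carrier
`G` of the group is a finite-dimensional real Lie algebra with a stratification, the group law is
the Baker-Campbell-Hausdorff product, the identity is `0`, the inverse of `x` is `-x`, and the
Haar measure is Lebesgue measure (an additive Haar measure) on the vector space `G`.
-/

namespace ProductHardy

noncomputable section

section OneGroup

/-- A stratification `G = V₁ ⊕ ⋯ ⊕ V_k` of a real Lie algebra, with `[V₁, V_j] = V_{j+1}` for
`1 ≤ j ≤ k` and `V_{k+1} = 0`. The layers are indexed by all natural numbers; those with an index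
outside `{1, …, k}` vanish. -/
structure Stratification (G : Type*) [LieRing G] [LieAlgebra ℝ G] where
  step : ℕ
  layer : ℕ → Submodule ℝ G
  isInternal : DirectSum.IsInternal layer
  layer_zero : layer 0 = ⊥
  layer_eq_bot : ∀ j, step < j → layer j = ⊥
  span_bracket : ∀ j, 1 ≤ j → j ≤ step →
    Submodule.span ℝ {z : G | ∃ x ∈ layer 1, ∃ y ∈ layer j, ⁅x, y⁆ = z} = layer (j + 1)

/-- The right-nested bracket `[x₁, [x₂, [… , x_m]…]]` of a list. -/
def nestedBracket {G : Type*} [LieRing G] : List G → G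
  | [] => 0
  | [x] => x
  | x :: y :: l => ⁅x, nestedBracket (y :: l)⁆

/-- The word `X^{r₁} Y^{s₁} ⋯ X^{r_n} Y^{s_n}`. -/
def bchWord {G : Type*} (x y : G) {n : ℕ} (r s : Fin n → ℕ) : List G :=
  (List.ofFn fun i => List.replicate (r i) x ++ List.replicate (s i) y).flatten

namespace Stratification

variable {G : Type*} [LieRing G] [LieAlgebra ℝ G] (S : Stratification G)

/-- The homogeneous dimension `Q = ∑ j dim V_j`. -/
def homDim : ℕ := ∑ j ∈ Finset.Icc 1 S.step, j * Module.finrank ℝ (S.layer j)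

/-- The component `X_j` in the layer `V_j` of an element `X = X₁ + ⋯ + X_k`. -/
def component (j : ℕ) (x : G) : G :=
  letI := S.isInternal.chooseDecomposition
  (DirectSum.decompose S.layer x j : G)

theorem component_of_mem_same {j : ℕ} {x : G} (hx : x ∈ S.layer j) : S.component j x = x := by
  letI := S.isInternal.chooseDecomposition
  exact DirectSum.decompose_of_mem_same S.layer hx

theorem component_of_mem_ne {i j : ℕ} {x : G} (hx : x ∈ S.layer i) (hij : i ≠ j) :
    S.component j x = 0 := by
  letI := S.isInternal.chooseDecomposition
  exact DirectSum.decompose_of_mem_ne S.layer hx hij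

/-- The dilation `δ_t (X₁ + ⋯ + X_k) = t X₁ + ⋯ + t^k X_k`. -/
def dilation (t : ℝ) (x : G) : G := ∑ j ∈ Finset.Icc 1 S.step, t ^ j • S.component j x

/-- The group law, given by the Baker-Campbell-Hausdorff formula in Dynkin's form
`∑_{n ≥ 1} (-1)^{n-1}/n ∑ [X^{r₁} Y^{s₁} ⋯ X^{r_n} Y^{s_n}] /
  ((∑ (r_i + s_i)) ∏ r_i! s_i!)`,
where the inner sum is over all `r, s` such that `r_i + s_i > 0` for all `i`. Brackets of more
than `step` letters vanish, so `n`, `r_i` and `s_i` need only run up to `step`. -/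
def mul (x y : G) : G :=
  ∑ n ∈ Finset.Icc 1 S.step,
    ∑ p : Fin n → Fin (S.step + 1) × Fin (S.step + 1) with
        ∀ i, 0 < ((p i).1 : ℕ) + ((p i).2 : ℕ),
      ((-1 : ℝ) ^ (n - 1) / (n : ℝ) /
        ((∑ i, (((p i).1 : ℕ) + ((p i).2 : ℕ)) : ℕ) : ℝ) /
        ((∏ i, ((p i).1 : ℕ).factorial * ((p i).2 : ℕ).factorial : ℕ) : ℝ)) •
        nestedBracket (bchWord x y (fun i => ((p i).1 : ℕ)) (fun i => ((p i).2 : ℕ)))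

/-- The normalised dilate `φ_t = t^{-Q} φ ∘ δ_{1/t}`. -/
def dilate (φ : G → ℂ) (t : ℝ) (x : G) : ℂ :=
  (((t ^ S.homDim)⁻¹ : ℝ) : ℂ) * φ (S.dilation t⁻¹ x)

end Stratification

variable {G : Type*} [LieRing G] [LieAlgebra ℝ G] [TopologicalSpace G]

/-- A (continuous, symmetric, subadditive) homogeneous norm on a stratified group. -/
structure HomogeneousNorm (S : Stratification G) where
  toFun : G → ℝ
  continuous : Continuous toFun
  nonneg : ∀ x, 0 ≤ toFun x
  inv : ∀ x, toFun (-x) = toFun x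
  subadd : ∀ x y, toFun (S.mul x y) ≤ toFun x + toFun y
  homogeneous : ∀ t : ℝ, 0 < t → ∀ x, toFun (S.dilation t x) = t * toFun x
  eq_zero_iff : ∀ x, toFun x = 0 ↔ x = 0

namespace HomogeneousNorm

variable {S : Stratification G} (ρ : HomogeneousNorm S)

/-- The distance `ρ(g, h) = ρ(g⁻¹ h)`. -/
def dist (g h : G) : ℝ := ρ.toFun (S.mul (-g) h)

/-- The open ball `B(g, r)`. -/
def ball (g : G) (r : ℝ) : Set G := {h | ρ.dist g h < r}

/-- The standard decay and smoothness conditions with parameter `ε`, that is, `ψ ∈ M(G)`. -/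
def IsMolecule (ε : ℝ) (ψ : G → ℂ) : Prop :=
  ∃ C : ℝ,
    (∀ g, ‖ψ g‖ ≤ C * (1 / (1 + ρ.toFun g) ^ ((S.homDim : ℝ) + ε))) ∧
    (∀ g g', ‖ψ g - ψ g'‖ ≤ C * (ρ.dist g g' ^ ε /
      (1 + ρ.toFun g + ρ.toFun g') ^ ((S.homDim : ℝ) + 2 * ε)))

/-- Decay, smoothness and cancellation, that is, `ψ ∈ M₀(G)`. -/
def IsCancellingMolecule [MeasurableSpace G] (μ : Measure G) (ε : ℝ) (ψ : G → ℂ) : Prop :=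
  ρ.IsMolecule ε ψ ∧ ∫ g, ψ g ∂μ = 0

end HomogeneousNorm

end OneGroup

section Product

variable {G₁ G₂ : Type*}
  [LieRing G₁] [LieAlgebra ℝ G₁] [TopologicalSpace G₁] [MeasurableSpace G₁]
  [LieRing G₂] [LieAlgebra ℝ G₂] [TopologicalSpace G₂] [MeasurableSpace G₂]
  {S₁ : Stratification G₁} {S₂ : Stratification G₂}

/-- The convolution `(f ∗ φ)(g) = ∫ f(h) φ(h⁻¹ g) dh` on `G₁ × G₂`. -/
def conv (S₁ : Stratification G₁) (S₂ : Stratification G₂) (μ₁ : Measure G₁) (μ₂ : Measure G₂)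
    (f φ : G₁ × G₂ → ℂ) (g : G₁ × G₂) : ℂ :=
  ∫ h, f h * φ (S₁.mul (-h.1) g.1, S₂.mul (-h.2) g.2) ∂(μ₁.prod μ₂)

/-- `ψ_𝐭 = ψ₁_{t₁} ⊗ ψ₂_{t₂}`. -/
def tensorDilate (S₁ : Stratification G₁) (S₂ : Stratification G₂) (ψ₁ : G₁ → ℂ) (ψ₂ : G₂ → ℂ)
    (t : ℝ × ℝ) (g : G₁ × G₂) : ℂ :=
  S₁.dilate ψ₁ t.1 g.1 * S₂.dilate ψ₂ t.2 g.2

/-- The product cone `Γ^β(g)`, as a subset of `(G₁ × G₂) × (ℝ × ℝ)`. -/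
def cone (ρ₁ : HomogeneousNorm S₁) (ρ₂ : HomogeneousNorm S₂) (β : ℝ) (g : G₁ × G₂) :
    Set ((G₁ × G₂) × (ℝ × ℝ)) :=
  {p | 0 < p.2.1 ∧ 0 < p.2.2 ∧
    ρ₁.dist g.1 p.1.1 ≤ β * p.2.1 ∧ ρ₂.dist g.2 p.1.2 ≤ β * p.2.2}

/-- The rectangle `R(g, r) = B₁(g₁, r₁) × B₂(g₂, r₂)`. -/
def rectangle (ρ₁ : HomogeneousNorm S₁) (ρ₂ : HomogeneousNorm S₂) (g : G₁ × G₂) (r : ℝ × ℝ) :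
    Set (G₁ × G₂) :=
  ρ₁.ball g.1 r.1 ×ˢ ρ₂.ball g.2 r.2

/-- The area function
`S_{ψ,β}(f)(g) = (∬_{Γ^β(g)} |f ∗ ψ_𝐭 (h)|² / |R(o, β𝐭)| dh d𝐭 / (t₁ t₂))^{1/2}`,
with values in `[0, ∞]`. -/
def areaFunction (ρ₁ : HomogeneousNorm S₁) (ρ₂ : HomogeneousNorm S₂)
    (μ₁ : Measure G₁) (μ₂ : Measure G₂) (ψ₁ : G₁ → ℂ) (ψ₂ : G₂ → ℂ) (β : ℝ)
    (f : G₁ × G₂ → ℂ) (g : G₁ × G₂) : ℝ≥0∞ :=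
  (∫⁻ p in cone ρ₁ ρ₂ β g,
      ‖conv S₁ S₂ μ₁ μ₂ f (tensorDilate S₁ S₂ ψ₁ ψ₂ p.2) p.1‖ₑ ^ 2 /
        (μ₁.prod μ₂) (rectangle ρ₁ ρ₂ (0, 0) (β * p.2.1, β * p.2.2)) /
        ENNReal.ofReal (p.2.1 * p.2.2)
    ∂((μ₁.prod μ₂).prod volume)) ^ (1 / 2 : ℝ)

/-- `‖S_{ψ,β}(f)‖_{L¹(G₁ × G₂)}`, with values in `[0, ∞]`. -/
def areaNorm (ρ₁ : HomogeneousNorm S₁) (ρ₂ : HomogeneousNorm S₂)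
    (μ₁ : Measure G₁) (μ₂ : Measure G₂) (ψ₁ : G₁ → ℂ) (ψ₂ : G₂ → ℂ) (β : ℝ)
    (f : Lp ℂ 1 (μ₁.prod μ₂)) : ℝ≥0∞ :=
  ∫⁻ g, areaFunction ρ₁ ρ₂ μ₁ μ₂ ψ₁ ψ₂ β f g ∂(μ₁.prod μ₂)

/-- The Hardy space `H¹_{sq,ψ,β}(G₁ × G₂)`, as a subset of `L¹(G₁ × G₂)`; its norm is
`areaNorm`. -/
def hardySpace (ρ₁ : HomogeneousNorm S₁) (ρ₂ : HomogeneousNorm S₂)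
    (μ₁ : Measure G₁) (μ₂ : Measure G₂) (ψ₁ : G₁ → ℂ) (ψ₂ : G₂ → ℂ) (β : ℝ) :
    Set (Lp ℂ 1 (μ₁.prod μ₂)) :=
  {f | areaNorm ρ₁ ρ₂ μ₁ μ₂ ψ₁ ψ₂ β f < ∞}

end Product

end

end ProductHardy

open ProductHardy

/-! A change of aperture needs no information about the function. It holds in `L¹` for the square
root of any cone integral `A_α(x) = ∫ W(y) 1{d(x, h(y)) ≤ α t(y)} dν(y)` with a weight `W ≥ 0`, on
any space whose balls of radius `r` have measure `c r^Q`. Let `E = {A_β^{1/2} > l}`, call `(h, t)`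
bad if `E` fills at least half of `B(h, βt)`, and let `F` contain all balls `B(h, max(α,β) t)` with
`(h, t)` bad. Vitali's covering lemma gives `|F| ≲ |E|`. A cone of aperture `α` with vertex off `F`
sees only good points, for which `|B(h, βt)| ≤ 2 |B(h, βt) \ E|`; Fubini then gives `∫_{Fᶜ} A_α ≲
∫_{Eᶜ} A_β`. By Chebyshev, `|{A_α^{1/2} > l}| ≲ |E| + l⁻² ∫_{Eᶜ} A_β`, and integrating in `l` gives
the `L¹` bound, because `∫_u^∞ u² l⁻² dl = u` (`lintegral_sqrt_coneIntegral_le`).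

On a product, freeze one variable and absorb its cone condition into `W`. Two applications, one per
factor, change both apertures at the cost of `16 (5 max(α,β)/β)^{Q₁+Q₂}`
(`lintegral_sqrt_prodConeIntegral_le`). The division by `|R(o, β𝐭)|` contributes only a power of the
aperture (`areaFunction_eq`), which for large apertures helps.

It remains to see that a stratified group is such a space. Dynkin's formula, proved for nilpotent
elements of an associative algebra (`eventually_truncLog_eq_dynkin`), is carried over by a faithful
nilpotent representation and yields the group axioms (`truncExp_rep_mul`). Left translations have
Jacobian `1` (`det_fderiv_coordMul`), `δ_t` has determinant `t^Q`, and the unit ball lies in a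
compact set, so balls have measure `c r^Q`. -/

namespace ProductHardy

noncomputable section

/-! ### Truncated exponential and logarithm as mutually inverse series -/

section TruncatedSeries

open Polynomial

/-- The exponential series, truncated after the term of degree `K`. -/
def truncExp {A : Type*} [Ring A] [Algebra ℝ A] (K : ℕ) (a : A) : A :=
  ∑ i ∈ Finset.range (K + 1), ((i.factorial : ℝ)⁻¹) • a ^ i

/-- The series of `log (1 + u)`, truncated after the term of degree `K`. -/
def truncLog {A : Type*} [Ring A] [Algebra ℝ A] (K : ℕ) (u : A) : A :=
  ∑ n ∈ Finset.Icc 1 K, ((-1 : ℝ) ^ (n - 1) / (n : ℝ)) • u ^ n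

section Maps

variable {A B : Type*} [Ring A] [Algebra ℝ A] [Ring B] [Algebra ℝ B]

theorem map_truncExp (f : A →ₐ[ℝ] B) (K : ℕ) (a : A) :
    f (truncExp K a) = truncExp K (f a) := by
  simp [truncExp]

theorem map_truncLog (f : A →ₐ[ℝ] B) (K : ℕ) (a : A) :
    f (truncLog K a) = truncLog K (f a) := by
  simp [truncLog]

end Maps

theorem X_pow_succ_dvd_of_derivative {P : ℝ[X]} {K : ℕ} (h0 : P.coeff 0 = 0)
    (h : X ^ K ∣ derivative P) : X ^ (K + 1) ∣ P := by
  rw [X_pow_dvd_iff] at h ⊢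
  intro d hd
  cases d with
  | zero => exact h0
  | succ d =>
    have := h d (by omega)
    rw [coeff_derivative] at this
    have h1 : ((d : ℝ) + 1) ≠ 0 := by positivity
    exact (mul_eq_zero.mp this).resolve_right h1

theorem derivative_truncExp_X (K : ℕ) :
    derivative (truncExp K (X : ℝ[X])) =
      truncExp K X - C ((K.factorial : ℝ)⁻¹) * X ^ K := by
  induction K with
  | zero => simp [truncExp]
  | succ K ih =>
    have e : ∀ K, truncExp (K + 1) (X : ℝ[X]) =
        truncExp K X + C (((K + 1).factorial : ℝ)⁻¹) * X ^ (K + 1) := fun K => by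
      rw [truncExp, Finset.sum_range_succ, ← truncExp, smul_eq_C_mul]
    rw [e, derivative_add, ih, derivative_C_mul_X_pow]
    have : ((K + 1).factorial : ℝ)⁻¹ * ((K + 1 : ℕ) : ℝ) = (K.factorial : ℝ)⁻¹ := by
      rw [Nat.factorial_succ]; push_cast; field_simp
    rw [this]; simp

theorem one_add_X_mul_derivative_truncLog_X (K : ℕ) :
    (1 + X) * derivative (truncLog K (X : ℝ[X])) = 1 - (-X) ^ K := by
  induction K with
  | zero => simp [truncLog]
  | succ K ih =>
    have e : truncLog (K + 1) (X : ℝ[X]) =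
        truncLog K X + C ((-1) ^ K / ((K + 1 : ℕ) : ℝ)) * X ^ (K + 1) := by
      rw [truncLog, Finset.sum_Icc_succ_top (by omega), ← truncLog, smul_eq_C_mul]; simp
    rw [e, derivative_add, mul_add, ih, derivative_C_mul_X_pow]
    have : (-1 : ℝ) ^ K / ((K + 1 : ℕ) : ℝ) * ((K + 1 : ℕ) : ℝ) = (-1) ^ K := by
      push_cast; field_simp
    rw [this, Nat.add_sub_cancel, neg_pow, neg_pow (X : ℝ[X]) (K + 1)]
    simp; ring

theorem coeff_zero_truncExp (K : ℕ) : (truncExp K (X : ℝ[X])).coeff 0 = 1 := by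
  rw [truncExp, finsetSum_coeff, Finset.sum_range_succ']
  simp

theorem coeff_zero_truncLog (K : ℕ) : (truncLog K (X : ℝ[X])).coeff 0 = 0 := by
  rw [truncLog, finsetSum_coeff]
  refine Finset.sum_eq_zero fun n hn => ?_
  rw [Finset.mem_Icc] at hn
  simp [coeff_X_pow, show 0 ≠ n by omega]

theorem isCoprime_X_pow_one_add {P : ℝ[X]} (h : P.coeff 0 ≠ 0) (K : ℕ) : IsCoprime (X ^ K) P := by
  refine IsCoprime.pow_left ?_
  rw [(irreducible_X).coprime_iff_not_dvd, X_dvd_iff]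
  exact h

theorem X_pow_dvd_of_coeff_zero {P : ℝ[X]} (h : P.coeff 0 = 0) (K : ℕ) : X ^ K ∣ P ^ K :=
  pow_dvd_pow_of_dvd (X_dvd_iff.mpr h) K

/-- The derivative of the right-hand side, multiplied by `E = truncExp K X`, is divisible by `X ^
K`, because `E' = E - X^K / K!` and `(1 + X) L' = 1 - (-X)^K`. The factor `E` can be cancelled, its
constant coefficient being `1`. -/
theorem truncLog_truncExp_X_dvd (K : ℕ) :
    X ^ (K + 1) ∣ (truncLog K (X : ℝ[X])).comp (truncExp K X - 1) - X := by
  set E := truncExp K (X : ℝ[X]) with hE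
  have hE0 : (E - 1).coeff 0 = 0 := by simp [hE, coeff_zero_truncExp]
  refine X_pow_succ_dvd_of_derivative ?_ ?_
  · rw [coeff_sub, coeff_X_zero, sub_zero, coeff_zero_eq_eval_zero, eval_comp,
      ← coeff_zero_eq_eval_zero, hE0, ← coeff_zero_eq_eval_zero, coeff_zero_truncLog]
  · have hc : IsCoprime (X ^ K) E :=
      isCoprime_X_pow_one_add (by simp [hE, coeff_zero_truncExp]) K
    refine hc.dvd_of_dvd_mul_left ?_
    have h1 := congrArg (fun p => p.comp (E - 1)) (one_add_X_mul_derivative_truncLog_X K)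
    simp only [mul_comp, add_comp, one_comp, X_comp, sub_comp, pow_comp, neg_comp] at h1
    rw [show (1 + (E - 1)) = E by ring] at h1
    have h2 : E * derivative ((truncLog K X).comp (E - 1) - X) =
        - ((E - 1) ^ K * ((-1) ^ K * derivative E)) - X ^ K * C ((K.factorial : ℝ)⁻¹) := by
      rw [derivative_sub, derivative_comp, derivative_X, derivative_sub, derivative_one, sub_zero,
        mul_sub, mul_left_comm, h1, mul_one, mul_sub, mul_one, neg_pow]
      have := derivative_truncExp_X K
      rw [← hE] at this
      linear_combination this
    rw [h2]
    exact dvd_sub ((dvd_mul_of_dvd_left (X_pow_dvd_of_coeff_zero hE0 K) _).neg_right)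
      (dvd_mul_right _ _)

/-- The difference `H` vanishes at `0` and solves `(1 + X) H' = H` modulo `X ^ K`. So `X ^ j ∣ H`
implies `X ^ j ∣ H'`, hence `X ^ (j + 1) ∣ H`, as long as `j ≤ K`. -/
theorem truncExp_truncLog_X_dvd (K : ℕ) :
    X ^ (K + 1) ∣ (truncExp K (X : ℝ[X])).comp (truncLog K X) - (1 + X) := by
  set L := truncLog K (X : ℝ[X]) with hL
  have hL0 : L.coeff 0 = 0 := coeff_zero_truncLog K
  set H := (truncExp K (X : ℝ[X])).comp L - (1 + X) with hH
  have hH0 : H.coeff 0 = 0 := by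
    rw [hH, coeff_sub, coeff_add, coeff_X_zero, coeff_zero_eq_eval_zero, eval_comp,
      ← coeff_zero_eq_eval_zero, hL0, ← coeff_zero_eq_eval_zero, coeff_zero_truncExp]
    simp
  have key : X ^ K ∣ (1 + X) * derivative H - H := by
    have h1 := congrArg (fun p => p.comp L) (derivative_truncExp_X K)
    simp only [mul_comp, X_comp, sub_comp, pow_comp, C_comp] at h1
    have h2 := one_add_X_mul_derivative_truncLog_X K
    rw [← hL, neg_pow] at h2
    have h3 : (1 + X) * derivative H - H =
        - (X ^ K * ((-1) ^ K * (derivative (truncExp K X)).comp L))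
          - L ^ K * C ((K.factorial : ℝ)⁻¹) := by
      rw [hH, derivative_sub, derivative_comp, derivative_add, derivative_X, derivative_one]
      linear_combination (derivative (truncExp K X)).comp L * h2 + h1
    rw [h3]
    exact dvd_sub ((dvd_mul_right _ _).neg_right)
      (dvd_mul_of_dvd_left (X_pow_dvd_of_coeff_zero hL0 K) _)
  have step : ∀ j ≤ K + 1, X ^ j ∣ H := by
    intro j
    induction j with
    | zero => simp
    | succ j ih =>
      intro hj
      refine X_pow_succ_dvd_of_derivative hH0 ?_
      have hc : IsCoprime (X ^ j) (1 + X : ℝ[X]) := isCoprime_X_pow_one_add (by simp) j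
      refine hc.dvd_of_dvd_mul_left ?_
      have := dvd_add ((pow_dvd_pow X (by omega : j ≤ K)).trans key) (ih (by omega))
      simpa using this
  exact step _ le_rfl

variable {A : Type*} [Ring A] [Algebra ℝ A]

theorem truncLog_truncExp {K : ℕ} {u : A} (hu : u ^ (K + 1) = 0) :
    truncLog K (truncExp K u - 1) = u := by
  obtain ⟨q, hq⟩ := truncLog_truncExp_X_dvd K
  have h := congrArg (aeval u) hq
  rw [map_sub, aeval_comp, map_mul, map_pow, aeval_X, hu, zero_mul, sub_eq_zero, map_truncLog,
    map_sub, map_truncExp, aeval_X, map_one, aeval_X] at h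
  exact h

theorem truncExp_truncLog {K : ℕ} {v : A} (hv : v ^ (K + 1) = 0) :
    truncExp K (truncLog K v) = 1 + v := by
  obtain ⟨q, hq⟩ := truncExp_truncLog_X_dvd K
  have h := congrArg (aeval v) hq
  rw [map_sub, aeval_comp, map_mul, map_pow, aeval_X, hv, zero_mul, sub_eq_zero, map_truncExp,
    map_truncLog, aeval_X, map_add, map_one, aeval_X] at h
  exact h

/-- On these nilpotent elements the truncation agrees with `IsNilpotent.exp`, whose functional
equation is available over `ℚ`. -/
theorem truncExp_add {K : ℕ} {a b : A} (hc : Commute a b) (ha : a ^ (K + 1) = 0)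
    (hb : b ^ (K + 1) = 0) (hab : (a + b) ^ (K + 1) = 0) :
    truncExp K (a + b) = truncExp K a * truncExp K b := by
  let _ : Algebra ℚ A := Algebra.compHom A (algebraMap ℚ ℝ)
  have e : ∀ u : A, u ^ (K + 1) = 0 → truncExp K u = IsNilpotent.exp u := by
    intro u hu
    rw [IsNilpotent.exp_eq_sum hu, truncExp]
    refine Finset.sum_congr rfl fun i _ => ?_
    change _ = (algebraMap ℚ ℝ ((i.factorial : ℚ)⁻¹)) • u ^ i
    simp
  rw [e _ hab, e _ ha, e _ hb, IsNilpotent.exp_add_of_commute hc ⟨_, ha⟩ ⟨_, hb⟩]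

theorem truncExp_zero (K : ℕ) : truncExp K (0 : A) = 1 := by
  rw [truncExp, Finset.sum_range_succ']
  simp

theorem truncExp_neg_mul_self {K : ℕ} {a : A} (ha : a ^ (K + 1) = 0) :
    truncExp K (-a) * truncExp K a = 1 := by
  rw [← truncExp_add (Commute.refl a).neg_left (by rw [neg_pow, ha, mul_zero]) ha (by simp),
    neg_add_cancel, truncExp_zero]

theorem isNilpotent_truncLog {K : ℕ} {u : A} (hu : IsNilpotent u) :
    IsNilpotent (truncLog K u) := by
  have : truncLog K u = aeval u (truncLog K (X : ℝ[X])) := by rw [map_truncLog, aeval_X]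
  obtain ⟨q, hq⟩ := X_dvd_iff.mpr (coeff_zero_truncLog K)
  rw [this, hq, map_mul, aeval_X]
  obtain ⟨m, hm⟩ := hu
  refine ⟨m, ?_⟩
  have hc : Commute u (aeval u q) := by
    have := (Commute.all X q).map (aeval u)
    rwa [aeval_X] at this
  rw [hc.mul_pow, hm, zero_mul]

end TruncatedSeries

attribute [local instance] LieRing.ofAssociativeRing

/-! ### Words in two letters and the logarithm of a product of exponentials -/

section Words

theorem bchWord_map {G H : Type*} (f : G → H) (x y : G) {n : ℕ} (r s : Fin n → ℕ) :
    (bchWord x y r s).map f = bchWord (f x) (f y) r s := by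
  simp [bchWord, List.map_flatten, List.map_ofFn, Function.comp_def]

theorem length_bchWord {G : Type*} (x y : G) {n : ℕ} (r s : Fin n → ℕ) :
    (bchWord x y r s).length = ∑ i, (r i + s i) := by
  simp [bchWord, List.length_flatten, List.map_ofFn, Function.comp_def, List.sum_ofFn]

theorem mem_bchWord {G : Type*} {x y z : G} {n : ℕ} {r s : Fin n → ℕ}
    (h : z ∈ bchWord x y r s) : z = x ∨ z = y := by
  simp only [bchWord, List.mem_flatten, List.mem_ofFn] at h
  obtain ⟨l, ⟨i, rfl⟩, hl⟩ := h
  rw [List.mem_append, List.mem_replicate, List.mem_replicate] at hl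
  tauto

theorem prod_bchWord {A : Type*} [Monoid A] (a b : A) {n : ℕ} (r s : Fin n → ℕ) :
    (bchWord a b r s).prod = (List.ofFn fun i => a ^ r i * b ^ s i).prod := by
  simp [bchWord, List.prod_flatten, List.map_ofFn, Function.comp_def]

theorem map_nestedBracket {G H : Type*} [LieRing G] [LieRing H] (f : G → H) (h0 : f 0 = 0)
    (hf : ∀ x y, f ⁅x, y⁆ = ⁅f x, f y⁆) (l : List G) :
    f (nestedBracket l) = nestedBracket (l.map f) := by
  match l with
  | [] => simpa [nestedBracket] using h0
  | [x] => simp [nestedBracket]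
  | x :: y :: l =>
    simp only [nestedBracket, List.map_cons, hf]
    rw [map_nestedBracket f h0 hf (y :: l), List.map_cons]

/-- Index pairs `(r_i, s_i)` with entries at most `K` and `r_i + s_i > 0`. -/
def bchIndex (K n : ℕ) : Finset (Fin n → ℕ × ℕ) :=
  Fintype.piFinset fun _ =>
    (Finset.range (K + 1) ×ˢ Finset.range (K + 1)).filter fun q => 0 < q.1 + q.2

theorem mem_bchIndex {K n : ℕ} {p : Fin n → ℕ × ℕ} :
    p ∈ bchIndex K n ↔ ∀ i, ((p i).1 ≤ K ∧ (p i).2 ≤ K) ∧ 0 < (p i).1 + (p i).2 := by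
  simp only [bchIndex, Fintype.mem_piFinset, Finset.mem_filter, Finset.mem_product,
    Finset.mem_range, Nat.lt_succ_iff]

/-- The word `X^{r₁} Y^{s₁} ⋯ X^{r_n} Y^{s_n}` of a family of pairs. -/
abbrev pairWord {G : Type*} (x y : G) {n : ℕ} (p : Fin n → ℕ × ℕ) : List G :=
  bchWord x y (fun i => (p i).1) (fun i => (p i).2)

/-- The degree `∑ (r_i + s_i)` of a family of pairs. -/
def pairDegree {n : ℕ} (p : Fin n → ℕ × ℕ) : ℕ := ∑ i, ((p i).1 + (p i).2)

theorem pairWord_map {G H : Type*} (f : G → H) (x y : G) {n : ℕ} (p : Fin n → ℕ × ℕ) :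
    (pairWord x y p).map f = pairWord (f x) (f y) p :=
  bchWord_map f x y _ _

theorem length_pairWord {G : Type*} (x y : G) {n : ℕ} (p : Fin n → ℕ × ℕ) :
    (pairWord x y p).length = pairDegree p :=
  length_bchWord x y _ _

/-- The coefficient of a word in `log (exp X exp Y)`. -/
def logCoeff {n : ℕ} (p : Fin n → ℕ × ℕ) : ℝ :=
  (-1 : ℝ) ^ (n - 1) / (n : ℝ) * ∏ i, (((p i).1.factorial : ℝ)⁻¹ * ((p i).2.factorial : ℝ)⁻¹)

theorem le_pairDegree {K n : ℕ} {p : Fin n → ℕ × ℕ} (hp : p ∈ bchIndex K n) :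
    n ≤ pairDegree p := by
  rw [mem_bchIndex] at hp
  calc n = ∑ _i : Fin n, 1 := by simp
    _ ≤ _ := Finset.sum_le_sum fun i _ => (hp i).2

theorem sum_pow_eq_sum_piFinset {A ι : Type*} [Semiring A] (S : Finset ι) (f : ι → A) (n : ℕ) :
    (∑ q ∈ S, f q) ^ n =
      ∑ p ∈ Fintype.piFinset fun _ : Fin n => S, (List.ofFn fun i => f (p i)).prod := by
  induction n with
  | zero => simp
  | succ n ih =>
    rw [pow_succ', ih, Finset.sum_mul_sum, ← Finset.sum_product']
    refine Finset.sum_nbij' (fun x => Fin.cons x.1 x.2) (fun p => (p 0, Fin.tail p))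
      ?_ ?_ ?_ ?_ ?_
    · rintro ⟨q, p⟩ h
      simp only [Finset.mem_product, Fintype.mem_piFinset] at h ⊢
      exact fun i => Fin.cases h.1 h.2 i
    · intro p h
      simp only [Finset.mem_product, Fintype.mem_piFinset] at h ⊢
      exact ⟨h 0, fun i => h i.succ⟩
    · rintro ⟨q, p⟩ _; simp
    · intro p _; simp
    · rintro ⟨q, p⟩ _; simp [List.ofFn_succ]

theorem list_prod_ofFn_smul {A : Type*} [Ring A] [Algebra ℝ A] {n : ℕ} (c : Fin n → ℝ)
    (m : Fin n → A) :
    (List.ofFn fun i => c i • m i).prod = (∏ i, c i) • (List.ofFn m).prod := by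
  induction n with
  | zero => simp
  | succ n ih =>
    rw [List.ofFn_succ, List.prod_cons, ih, List.ofFn_succ, List.prod_cons, Fin.prod_univ_succ,
      smul_mul_smul_comm]

variable {A : Type*} [Ring A] [Algebra ℝ A]

theorem truncExp_mul_sub_one (K : ℕ) (a b : A) :
    truncExp K a * truncExp K b - 1 =
      ∑ q ∈ (Finset.range (K + 1) ×ˢ Finset.range (K + 1)).filter (fun q => 0 < q.1 + q.2),
        ((q.1.factorial : ℝ)⁻¹ * (q.2.factorial : ℝ)⁻¹) • (a ^ q.1 * b ^ q.2) := by
  rw [truncExp, truncExp, Finset.sum_mul_sum, ← Finset.sum_product', sub_eq_iff_eq_add,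
    ← Finset.sum_filter_add_sum_filter_not _ (fun q : ℕ × ℕ => 0 < q.1 + q.2)]
  congr 1
  · exact Finset.sum_congr rfl fun q _ => by rw [smul_mul_smul_comm]
  · rw [Finset.sum_eq_single (0, 0)]
    · simp
    · intro q hq hne
      rw [Finset.mem_filter] at hq
      refine absurd (Prod.ext ?_ ?_) hne <;> omega
    · intro h; simp at h

theorem truncExp_mul_sub_one_pow (K n : ℕ) (a b : A) :
    (truncExp K a * truncExp K b - 1) ^ n = ∑ p ∈ bchIndex K n,
      (∏ i, (((p i).1.factorial : ℝ)⁻¹ * ((p i).2.factorial : ℝ)⁻¹)) • (pairWord a b p).prod := by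
  rw [truncExp_mul_sub_one, sum_pow_eq_sum_piFinset]
  refine Finset.sum_congr rfl fun p _ => ?_
  rw [list_prod_ofFn_smul, prod_bchWord]

theorem truncLog_truncExp_mul (K : ℕ) (a b : A) :
    truncLog K (truncExp K a * truncExp K b - 1) = ∑ n ∈ Finset.Icc 1 K, ∑ p ∈ bchIndex K n,
      logCoeff p • (pairWord a b p).prod := by
  refine Finset.sum_congr rfl fun n _ => ?_
  rw [truncExp_mul_sub_one_pow, Finset.smul_sum]
  exact Finset.sum_congr rfl fun p _ => by rw [smul_smul, logCoeff]

/-- All products of more than `N` factors, each of them `a` or `b`, vanish. -/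
def WordsVanish (N : ℕ) (a b : A) : Prop :=
  ∀ l : List A, (∀ x ∈ l, x = a ∨ x = b) → N < l.length → l.prod = 0

theorem WordsVanish.pow_left {A : Type*} [Ring A] {N : ℕ} {a b : A} (h : WordsVanish N a b) {m : ℕ} (hm : N < m) :
    a ^ m = 0 := by
  simpa using h (List.replicate m a) (fun x hx => Or.inl (List.eq_of_mem_replicate hx))
    (by simpa using hm)

theorem WordsVanish.pow_right {A : Type*} [Ring A] {N : ℕ} {a b : A} (h : WordsVanish N a b) {m : ℕ} (hm : N < m) :
    b ^ m = 0 := by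
  simpa using h (List.replicate m b) (fun x hx => Or.inr (List.eq_of_mem_replicate hx))
    (by simpa using hm)

theorem WordsVanish.truncExp_mul_sub_one_pow {N : ℕ} {a b : A} (h : WordsVanish N a b) (K : ℕ)
    {m : ℕ} (hm : N < m) : (truncExp K a * truncExp K b - 1) ^ m = 0 := by
  rw [ProductHardy.truncExp_mul_sub_one_pow]
  refine Finset.sum_eq_zero fun p hp => ?_
  rw [h _ (fun x hx => mem_bchWord hx), smul_zero]
  rw [length_bchWord]
  exact hm.trans_le (le_pairDegree hp)

/-- The innermost `ad` sends `d` to minus the last letter; the others then build the nested bracket.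
Evaluation at `d` is thus what turns associative words into brackets. -/
theorem prod_map_ad_apply {d : A} (l : List A) (hl : l ≠ []) (h : ∀ x ∈ l, ⁅d, x⁆ = x) :
    ((l.map fun x => LieAlgebra.ad ℝ A x).prod) d = -nestedBracket l := by
  match l with
  | [] => exact absurd rfl hl
  | [x] =>
    have := h x (by simp)
    simp only [List.map_cons, List.map_nil, List.prod_singleton, LieAlgebra.ad_apply,
      nestedBracket]
    rw [← lie_skew, this]
  | x :: y :: l =>
    rw [List.map_cons, List.prod_cons, Module.End.mul_apply,
      prod_map_ad_apply (y :: l) (by simp) (fun z hz => h z (List.mem_cons_of_mem _ hz)),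
      LieAlgebra.ad_apply, nestedBracket, lie_neg]

/-- `ad a` is the sum of left multiplication by `a` and right multiplication by `-a`, which commute.
-/
theorem truncExp_ad {K : ℕ} {a : A} (ha : a ^ (K + 1) = 0)
    (had : (LieAlgebra.ad ℝ A a) ^ (K + 1) = 0) :
    truncExp K (LieAlgebra.ad ℝ A a) =
      LinearMap.mulLeft ℝ (truncExp K a) * LinearMap.mulRight ℝ (truncExp K (-a)) := by
  have e : LieAlgebra.ad ℝ A a = LinearMap.mulLeft ℝ a + LinearMap.mulRight ℝ (-a) := by
    ext x; simp [LieRing.of_associative_ring_bracket, sub_eq_add_neg]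
  have hl : truncExp K (LinearMap.mulLeft ℝ a) = LinearMap.mulLeft ℝ (truncExp K a) := by
    ext x; simp [truncExp, LinearMap.pow_mulLeft, Finset.sum_mul]
  have hr : truncExp K (LinearMap.mulRight ℝ (-a)) = LinearMap.mulRight ℝ (truncExp K (-a)) := by
    ext x; simp [truncExp, LinearMap.pow_mulRight, Finset.mul_sum]
  rw [e, truncExp_add (LinearMap.commute_mulLeft_right (R := ℝ) a (-a)), hl, hr]
  · rw [LinearMap.pow_mulLeft, ha, LinearMap.mulLeft_zero_eq_zero]
  · rw [LinearMap.pow_mulRight, neg_pow, ha, mul_zero, LinearMap.mulRight_zero_eq_zero]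
  · rw [← e, had]

theorem eventually_pow_succ_eq_zero {R : Type*} [MonoidWithZero R] {x : R} (hx : IsNilpotent x) :
    ∀ᶠ K : ℕ in Filter.atTop, x ^ (K + 1) = 0 := by
  obtain ⟨m, hm⟩ := hx
  filter_upwards [Filter.eventually_ge_atTop m] with K hK
  exact pow_eq_zero_of_le (by omega) hm

theorem truncExp_eq_of_le {k K : ℕ} (hkK : k ≤ K) {a : A} (ha : a ^ (k + 1) = 0) :
    truncExp K a = truncExp k a := by
  refine (Finset.sum_subset (by simpa using hkK) fun i _ hi => ?_).symm
  rw [pow_eq_zero_of_le (by simpa using hi) ha, smul_zero]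

theorem truncLog_eq_of_le {k K : ℕ} (hkK : k ≤ K) {a : A} (ha : a ^ (k + 1) = 0) :
    truncLog K a = truncLog k a := by
  refine (Finset.sum_subset (Finset.Icc_subset_Icc_right hkK) fun i h hi => ?_).symm
  rw [Finset.mem_Icc] at h hi
  rw [pow_eq_zero_of_le (by omega) ha, smul_zero]

/-- With `w = log (exp a exp b)`, conjugation gives `exp (ad w) = exp (ad a) exp (ad b)`. Hence `ad
w` is the same word series in `ad a` and `ad b`, and evaluating it at `d` produces brackets. The
truncation must be large since the nilpotency orders of `w`, `ad a`, `ad b` and `ad w` may exceed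
that of `a` and `b`. -/
theorem eventually_lie_truncLog {N : ℕ} {a b d : A} (h : WordsVanish N a b) (hda : d * a - a * d = a)
    (hdb : d * b - b * d = b) :
    ∀ᶠ K : ℕ in Filter.atTop, d * truncLog K (truncExp K a * truncExp K b - 1) -
      truncLog K (truncExp K a * truncExp K b - 1) * d = ∑ n ∈ Finset.Icc 1 K, ∑ p ∈ bchIndex K n,
        logCoeff p • nestedBracket (pairWord a b p) := by
  set w := truncLog N (truncExp N a * truncExp N b - 1) with hw
  have ha : a ^ (N + 1) = 0 := h.pow_left (by omega)
  have hb : b ^ (N + 1) = 0 := h.pow_right (by omega)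
  have hU : (truncExp N a * truncExp N b - 1) ^ (N + 1) = 0 :=
    h.truncExp_mul_sub_one_pow N (by omega)
  have hwn : IsNilpotent w := isNilpotent_truncLog ⟨_, hU⟩
  filter_upwards [Filter.eventually_ge_atTop N, eventually_pow_succ_eq_zero hwn,
    eventually_pow_succ_eq_zero (LieAlgebra.ad_nilpotent_of_nilpotent (R := ℝ) ⟨_, ha⟩),
    eventually_pow_succ_eq_zero (LieAlgebra.ad_nilpotent_of_nilpotent (R := ℝ) ⟨_, hb⟩),
    eventually_pow_succ_eq_zero (LieAlgebra.ad_nilpotent_of_nilpotent (R := ℝ) hwn)]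
    with K hK hwK haK hbK hadK
  have hwK' : truncLog K (truncExp K a * truncExp K b - 1) = w := by
    rw [truncExp_eq_of_le hK ha, truncExp_eq_of_le hK hb, truncLog_eq_of_le hK hU]
  have haK' : a ^ (K + 1) = 0 := h.pow_left (by omega)
  have hbK' : b ^ (K + 1) = 0 := h.pow_right (by omega)
  have hexp : truncExp K w = truncExp K a * truncExp K b := by
    rw [← hwK', truncExp_truncLog (h.truncExp_mul_sub_one_pow K (by omega)), add_sub_cancel]
  have hexpneg : truncExp K (-w) = truncExp K (-b) * truncExp K (-a) := by
    have h1 := truncExp_neg_mul_self hwK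
    have h2 : truncExp K w * (truncExp K (-b) * truncExp K (-a)) = 1 := by
      have h3 := truncExp_neg_mul_self (a := -b) (K := K) (by rw [neg_pow, hbK', mul_zero])
      have h4 := truncExp_neg_mul_self (a := -a) (K := K) (by rw [neg_pow, haK', mul_zero])
      rw [neg_neg] at h3 h4
      rw [hexp, mul_assoc, ← mul_assoc (truncExp K b), h3, one_mul, h4]
    calc truncExp K (-w) = truncExp K (-w) * (truncExp K w *
          (truncExp K (-b) * truncExp K (-a))) := by rw [h2, mul_one]
      _ = _ := by rw [← mul_assoc, h1, one_mul]
  have hAd : truncExp K (LieAlgebra.ad ℝ A w) =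
      truncExp K (LieAlgebra.ad ℝ A a) * truncExp K (LieAlgebra.ad ℝ A b) := by
    rw [truncExp_ad hwK hadK, truncExp_ad haK' haK, truncExp_ad hbK' hbK, hexp, hexpneg]
    ext x; simp [mul_assoc]
  have hlog := truncLog_truncExp hadK
  rw [hAd, truncLog_truncExp_mul] at hlog
  have happ := congrArg (fun f : Module.End ℝ A => f d) hlog
  simp only [LinearMap.sum_apply, LinearMap.smul_apply, LieAlgebra.ad_apply] at happ
  rw [hwK', ← LieRing.of_associative_ring_bracket, ← lie_skew, ← happ, ← Finset.sum_neg_distrib]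
  refine Finset.sum_congr rfl fun n hn => ?_
  rw [← Finset.sum_neg_distrib]
  refine Finset.sum_congr rfl fun p hp => ?_
  have hne : pairWord a b p ≠ [] := by
    intro h0
    have h1 := length_pairWord a b p
    have h2 := le_pairDegree hp
    rw [Finset.mem_Icc] at hn
    rw [h0, List.length_nil] at h1
    omega
  rw [← pairWord_map (fun x => LieAlgebra.ad ℝ A x), prod_map_ad_apply _ hne, smul_neg, neg_neg]
  intro x hx
  rcases mem_bchWord hx with rfl | rfl
  · exact hda
  · exact hdb

end Words

/-! ### Dynkin's formula, by adjoining a grading variable -/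

section Graded

variable {A : Type*} [Ring A] [Algebra ℝ A]

/-- Left multiplication by `a` composed with the shift by one degree. -/
def shiftMul (a : A) : Module.End ℝ (ℕ →₀ A) :=
  Finsupp.lsum ℝ fun n => (Finsupp.lsingle (n + 1)).comp (LinearMap.mulLeft ℝ a)

variable (A) in
/-- Multiplication of the component of degree `n` by `n`. -/
def degreeMul : Module.End ℝ (ℕ →₀ A) :=
  Finsupp.lsum ℝ fun n => (n : ℝ) • Finsupp.lsingle n

theorem shiftMul_single (a : A) (n : ℕ) (u : A) :
    shiftMul a (Finsupp.single n u) = Finsupp.single (n + 1) (a * u) := by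
  simp [shiftMul]

theorem degreeMul_single (n : ℕ) (u : A) :
    degreeMul A (Finsupp.single n u) = Finsupp.single n ((n : ℝ) • u) := by
  simp [degreeMul]

theorem lie_degreeMul_shiftMul (a : A) :
    degreeMul A * shiftMul a - shiftMul a * degreeMul A = shiftMul a := by
  refine Finsupp.lhom_ext fun n u => ?_
  rw [LinearMap.sub_apply, Module.End.mul_apply,
    Module.End.mul_apply, shiftMul_single, degreeMul_single, degreeMul_single, shiftMul_single,
    ← Finsupp.single_sub]
  congr 1
  rw [mul_smul_comm, ← sub_smul]
  simp

theorem prod_map_shiftMul_single (l : List A) (n : ℕ) (u : A) :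
    (l.map shiftMul).prod (Finsupp.single n u) = Finsupp.single (n + l.length) (l.prod * u) := by
  induction l with
  | nil => simp
  | cons a l ih =>
    rw [List.map_cons, List.prod_cons, Module.End.mul_apply, ih, shiftMul_single, List.prod_cons,
      List.length_cons, mul_assoc, add_assoc]

theorem nestedBracket_map_shiftMul_single (l : List A) (n : ℕ) (u : A) :
    nestedBracket (l.map shiftMul) (Finsupp.single n u) =
      Finsupp.single (n + l.length) (nestedBracket l * u) := by
  match l with
  | [] => simp [nestedBracket]
  | [x] => simp [nestedBracket, shiftMul_single]
  | x :: y :: l =>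
    have ih := nestedBracket_map_shiftMul_single (y :: l)
    simp only [List.map_cons] at ih
    simp only [List.map_cons, nestedBracket]
    rw [LieRing.of_associative_ring_bracket, LinearMap.sub_apply, Module.End.mul_apply,
      Module.End.mul_apply, ih, shiftMul_single, shiftMul_single, ih,
      show n + 1 + (y :: l).length = n + (y :: l).length + 1 by ring, ← Finsupp.single_sub,
      LieRing.of_associative_ring_bracket, sub_mul, mul_assoc, mul_assoc]
    rfl

theorem WordsVanish.shiftMul {N : ℕ} {a b : A} (h : WordsVanish N a b) :
    WordsVanish N (shiftMul a) (shiftMul b) := by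
  intro l hl hN
  have key : ∃ m : List A, l = m.map ProductHardy.shiftMul ∧ ∀ x ∈ m, x = a ∨ x = b := by
    clear hN
    induction l with
    | nil => exact ⟨[], by simp⟩
    | cons z l ih =>
      obtain ⟨m, rfl, hm⟩ := ih fun x hx => hl x (List.mem_cons_of_mem _ hx)
      rcases hl z (by simp) with rfl | rfl
      · exact ⟨a :: m, by simp, by simpa using hm⟩
      · exact ⟨b :: m, by simp, by simpa using hm⟩
  obtain ⟨m, rfl, hm⟩ := key
  refine Finsupp.lhom_ext fun n u => ?_
  rw [prod_map_shiftMul_single, h m hm (by simpa using hN)]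
  simp

/-- **Dynkin's form of the Baker-Campbell-Hausdorff formula** in an associative algebra. -/
theorem eventually_truncLog_eq_dynkin {N : ℕ} {a b : A} (h : WordsVanish N a b) :
    ∀ᶠ K : ℕ in Filter.atTop, truncLog K (truncExp K a * truncExp K b - 1) =
      ∑ n ∈ Finset.Icc 1 K, ∑ p ∈ bchIndex K n,
        (logCoeff p / (pairDegree p : ℝ)) • nestedBracket (pairWord a b p) := by
  -- A suitable `d` need not exist in `A`. It does on `A[T]`, modelled by `ℕ →₀ A`: with `D = T
  -- d/dT` and letters `aT`, `bT` one has `[D, aT] = aT` for every `a`.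
  filter_upwards [eventually_lie_truncLog h.shiftMul (lie_degreeMul_shiftMul a)
    (lie_degreeMul_shiftMul b)] with K hK
  have h1 := congrArg (fun f : Module.End ℝ (ℕ →₀ A) => f (Finsupp.single 0 1)) hK
  simp only [LinearMap.sub_apply, Module.End.mul_apply,
    degreeMul_single, Nat.cast_zero, zero_smul, Finsupp.single_zero, map_zero, sub_zero,
    truncLog_truncExp_mul, LinearMap.sum_apply, LinearMap.smul_apply, map_sum, map_smul,
    ← pairWord_map shiftMul, prod_map_shiftMul_single, nestedBracket_map_shiftMul_single, mul_one,
    zero_add, length_pairWord] at h1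
  -- Evaluated at `1`, each word of degree `m` carries a factor `m` from `D`. Dividing the
  -- coefficient of `T^m` by `m` removes it on the left and creates Dynkin's denominator on the
  -- right; the sum over `m` forgets the grading.
  have h2 := congrArg (Finsupp.lsum ℝ fun m : ℕ => ((m : ℝ)⁻¹ • LinearMap.id : A →ₗ[ℝ] A)) h1
  simp only [map_sum, map_smul, Finsupp.lsum_single, LinearMap.smul_apply, LinearMap.id_apply]
    at h2
  rw [truncLog_truncExp_mul]
  calc _ = _ := ?_
    _ = _ := h2
    _ = _ := ?_
  · refine Finset.sum_congr rfl fun n hn => Finset.sum_congr rfl fun p hp => ?_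
    have : (pairDegree p : ℝ) ≠ 0 := by
      have := le_pairDegree hp
      rw [Finset.mem_Icc] at hn
      exact_mod_cast (by omega : pairDegree p ≠ 0)
    rw [smul_smul (pairDegree p : ℝ), mul_inv_cancel₀ this, one_smul]
  · refine Finset.sum_congr rfl fun n _ => Finset.sum_congr rfl fun p _ => ?_
    rw [smul_smul, div_eq_mul_inv]

end Graded

/-! ### The Baker-Campbell-Hausdorff product is a group law -/

namespace Stratification

variable {G : Type*} [LieRing G] [LieAlgebra ℝ G] (S : Stratification G)

theorem mem_layer_eq_zero {j : ℕ} (hj : j ∉ Finset.Icc 1 S.step) {x : G} (hx : x ∈ S.layer j) :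
    x = 0 := by
  rw [Finset.mem_Icc, not_and_or, not_le, not_le] at hj
  have : S.layer j = ⊥ := by
    rcases hj with hj | hj
    · rw [show j = 0 by omega, S.layer_zero]
    · exact S.layer_eq_bot j hj
  rwa [this, Submodule.mem_bot] at hx

theorem bracket_mem_one {j : ℕ} {x y : G} (hx : x ∈ S.layer 1) (hy : y ∈ S.layer j) :
    ⁅x, y⁆ ∈ S.layer (j + 1) := by
  by_cases hj : j ∈ Finset.Icc 1 S.step
  · rw [Finset.mem_Icc] at hj
    rw [← S.span_bracket j hj.1 hj.2]
    exact Submodule.subset_span ⟨x, hx, y, hy, rfl⟩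
  · rw [S.mem_layer_eq_zero hj hy, lie_zero]
    exact Submodule.zero_mem _

/-- Induction on `i`: `V_{i+1}` is spanned by `[V₁, V_i]`, and the Jacobi identity reduces to
brackets with `V₁` and with `V_i`. -/
theorem bracket_mem {i j : ℕ} {x y : G} (hx : x ∈ S.layer i) (hy : y ∈ S.layer j) :
    ⁅x, y⁆ ∈ S.layer (i + j) := by
  induction i generalizing x y j with
  | zero =>
    rw [S.mem_layer_eq_zero (by simp) hx, zero_lie]
    exact Submodule.zero_mem _
  | succ i ih =>
    by_cases hi : i ∈ Finset.Icc 1 S.step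
    · rw [Finset.mem_Icc] at hi
      rw [← S.span_bracket i hi.1 hi.2] at hx
      induction hx using Submodule.span_induction with
      | mem z hz =>
        obtain ⟨u, hu, v, hv, rfl⟩ := hz
        rw [lie_lie]
        refine Submodule.sub_mem _ ?_ ?_
        · have := S.bracket_mem_one hu (ih hv hy)
          rwa [show i + j + 1 = i + 1 + j by ring] at this
        · have := ih hv (S.bracket_mem_one hu hy)
          rwa [show i + (j + 1) = i + 1 + j by ring] at this
      | zero => rw [zero_lie]; exact Submodule.zero_mem _
      | add u v _ _ hu hv => rw [add_lie]; exact Submodule.add_mem _ hu hv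
      | smul c u _ hu => rw [smul_lie]; exact Submodule.smul_mem _ c hu
    · rcases Nat.eq_zero_or_pos i with rfl | hi0
      · rw [add_comm (0 + 1) j]
        exact S.bracket_mem_one hx hy
      · rw [S.mem_layer_eq_zero (j := i + 1) ?_ hx, zero_lie]
        · exact Submodule.zero_mem _
        · rw [Finset.mem_Icc] at hi ⊢
          omega

/-- Linear maps that agree on all layers are equal. -/
theorem ext_layer {H : Type*} [AddCommGroup H] [Module ℝ H] {f g : G →ₗ[ℝ] H}
    (h : ∀ j ∈ Finset.Icc 1 S.step, ∀ x ∈ S.layer j, f x = g x) : f = g := by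
  ext x
  have hx : x ∈ ⨆ j, S.layer j := by
    rw [S.isInternal.submodule_iSup_eq_top]; exact Submodule.mem_top
  induction hx using Submodule.iSup_induction' with
  | mem j x hx =>
    by_cases hj : j ∈ Finset.Icc 1 S.step
    · exact h j hj x hx
    · rw [S.mem_layer_eq_zero hj hx, map_zero, map_zero]
  | zero => rw [map_zero, map_zero]
  | add x y _ _ hx hy => rw [map_add, map_add, hx, hy]

/-- The projection to a layer as a linear map. -/
def componentLM (j : ℕ) : G →ₗ[ℝ] G :=
  let _ := S.isInternal.chooseDecomposition
  (S.layer j).subtype ∘ₗ DirectSum.component ℝ ℕ (fun i => S.layer i) j ∘ₗ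
    (DirectSum.decomposeLinearEquiv S.layer).toLinearMap

theorem componentLM_apply (j : ℕ) (x : G) : S.componentLM j x = S.component j x := rfl

/-- The linear map that multiplies the layer `V_j` by `c j`. -/
def layerScale (c : ℕ → ℝ) : G →ₗ[ℝ] G := ∑ j ∈ Finset.Icc 1 S.step, c j • S.componentLM j

theorem layerScale_of_mem (c : ℕ → ℝ) {j : ℕ} {x : G} (hx : x ∈ S.layer j) :
    S.layerScale c x = c j • x := by
  by_cases hj : j ∈ Finset.Icc 1 S.step
  · rw [layerScale, LinearMap.sum_apply, Finset.sum_eq_single_of_mem j hj]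
    · rw [LinearMap.smul_apply, componentLM_apply, S.component_of_mem_same hx]
    · intro i _ hij
      rw [LinearMap.smul_apply, componentLM_apply, S.component_of_mem_ne hx hij.symm, smul_zero]
  · rw [S.mem_layer_eq_zero hj hx, map_zero, smul_zero]

theorem layerScale_apply (c : ℕ → ℝ) (x : G) :
    S.layerScale c x = ∑ j ∈ Finset.Icc 1 S.step, c j • S.component j x := by
  simp [layerScale, componentLM_apply]

theorem layerScale_mul (c d : ℕ → ℝ) (x : G) :
    S.layerScale c (S.layerScale d x) = S.layerScale (fun j => c j * d j) x := by
  have : S.layerScale c ∘ₗ S.layerScale d = S.layerScale fun j => c j * d j := by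
    refine S.ext_layer fun j _ x hx => ?_
    rw [LinearMap.comp_apply, S.layerScale_of_mem d hx, map_smul, S.layerScale_of_mem c hx,
      S.layerScale_of_mem _ hx, smul_smul, mul_comm]
  exact congrArg (fun f => f x) this

theorem layerScale_eq_self {c : ℕ → ℝ} (hc : ∀ j, 1 ≤ j → c j = 1) (x : G) :
    S.layerScale c x = x := by
  have : S.layerScale c = LinearMap.id := by
    refine S.ext_layer fun j hj x hx => ?_
    rw [S.layerScale_of_mem c hx, hc j (Finset.mem_Icc.mp hj).1, one_smul, LinearMap.id_apply]
  exact congrArg (fun f => f x) this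

theorem dilation_eq_layerScale (t : ℝ) (x : G) :
    S.dilation t x = S.layerScale (fun j => t ^ j) x :=
  (S.layerScale_apply _ x).symm

/-- The derivation that multiplies the layer `V_j` by `j`. -/
def degree : G →ₗ[ℝ] G := S.layerScale fun j => (j : ℝ)

theorem ext_layer₂ {H : Type*} [AddCommGroup H] [Module ℝ H] {f g : G →ₗ[ℝ] G →ₗ[ℝ] H}
    (h : ∀ i, ∀ x ∈ S.layer i, ∀ j, ∀ y ∈ S.layer j, f x y = g x y) (x y : G) :
    f x y = g x y := by
  have : f = g := S.ext_layer fun i _ x hx => S.ext_layer fun j _ y hy => h i x hx j y hy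
  rw [this]

/-- The Lie bracket as a bilinear map. -/
abbrev bracketLM (G : Type*) [LieRing G] [LieAlgebra ℝ G] : G →ₗ[ℝ] G →ₗ[ℝ] G :=
  LinearMap.mk₂ ℝ (fun x y => ⁅x, y⁆) add_lie smul_lie lie_add lie_smul

theorem degree_lie (x y : G) : S.degree ⁅x, y⁆ = ⁅S.degree x, y⁆ + ⁅x, S.degree y⁆ := by
  refine S.ext_layer₂ (f := (bracketLM G).compr₂ S.degree)
    (g := (bracketLM G) ∘ₗ S.degree + (bracketLM G).compl₂ S.degree) ?_ x y
  intro i x hx j y hy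
  simp only [LinearMap.compr₂_apply, LinearMap.mk₂_apply, LinearMap.add_apply,
    LinearMap.comp_apply, LinearMap.compl₂_apply, degree]
  rw [S.layerScale_of_mem _ (S.bracket_mem hx hy), S.layerScale_of_mem _ hx,
    S.layerScale_of_mem _ hy, smul_lie, lie_smul, ← add_smul, Nat.cast_add]

theorem dilation_lie (t : ℝ) (x y : G) :
    S.dilation t ⁅x, y⁆ = ⁅S.dilation t x, S.dilation t y⁆ := by
  simp only [dilation_eq_layerScale]
  refine S.ext_layer₂ (f := (bracketLM G).compr₂ (S.layerScale fun j => t ^ j))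
    (g := ((bracketLM G).compl₂ (S.layerScale fun j => t ^ j)) ∘ₗ
      (S.layerScale fun j => t ^ j)) ?_ x y
  intro i x hx j y hy
  simp only [LinearMap.compr₂_apply, LinearMap.mk₂_apply,
    LinearMap.comp_apply, LinearMap.compl₂_apply]
  rw [S.layerScale_of_mem _ (S.bracket_mem hx hy), S.layerScale_of_mem _ hx,
    S.layerScale_of_mem _ hy, smul_lie, lie_smul, smul_smul, pow_add]

theorem degree_injective : Function.Injective S.degree := by
  refine Function.LeftInverse.injective (g := S.layerScale fun j => (j : ℝ)⁻¹) fun x => ?_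
  rw [degree, layerScale_mul]
  refine S.layerScale_eq_self (fun j hj => inv_mul_cancel₀ ?_) x
  exact_mod_cast (by omega : j ≠ 0)

/-- The sum of the layers of index at least `k`. -/
def filtration (k : ℕ) : Submodule ℝ G := ⨆ j ≥ k, S.layer j

theorem mem_filtration_one (x : G) : x ∈ S.filtration 1 := by
  have hx : x ∈ ⨆ j, S.layer j := by
    rw [S.isInternal.submodule_iSup_eq_top]; exact Submodule.mem_top
  refine (iSup_le fun j => ?_ : ⨆ j, S.layer j ≤ S.filtration 1) hx
  rcases Nat.eq_zero_or_pos j with rfl | hj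
  · rw [S.layer_zero]; exact bot_le
  · exact le_iSup₂_of_le j hj le_rfl

theorem eq_zero_of_mem_filtration {k : ℕ} (hk : S.step < k) {x : G}
    (hx : x ∈ S.filtration k) : x = 0 := by
  have : S.filtration k = ⊥ :=
    eq_bot_iff.mpr (iSup₂_le fun j hj => (S.layer_eq_bot j (by omega)).le)
  rwa [this, Submodule.mem_bot] at hx

theorem lie_mem_filtration {k : ℕ} (x : G) {y : G} (hy : y ∈ S.filtration k) :
    ⁅x, y⁆ ∈ S.filtration (k + 1) := by
  have hmap : S.filtration k ≤ (S.filtration (k + 1)).comap (bracketLM G x) := by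
    refine iSup₂_le fun j hj y hy => ?_
    have hx := S.mem_filtration_one x
    have : S.filtration 1 ≤ (S.filtration (k + 1)).comap ((bracketLM G).flip y) := by
      refine iSup₂_le fun i hi x hx => ?_
      exact (le_iSup₂_of_le (i + j) (by omega) le_rfl :
        S.layer (i + j) ≤ S.filtration (k + 1)) (S.bracket_mem hx hy)
    exact this hx
  exact hmap hy

theorem nestedBracket_mem_filtration (l : List G) : nestedBracket l ∈ S.filtration l.length := by
  match l with
  | [] => exact Submodule.zero_mem _
  | [x] => exact S.mem_filtration_one x
  | x :: y :: l => exact S.lie_mem_filtration x (nestedBracket_mem_filtration (y :: l))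

/-- A faithful nilpotent representation of a graded Lie algebra: the adjoint representation on the
extension by the degree derivation. -/
def rep : G →ₗ[ℝ] Module.End ℝ (G × ℝ) :=
  LinearMap.mk₂ ℝ (fun g w => (⁅g, w.1⁆ + w.2 • S.degree g, (0 : ℝ)))
    (fun g h w => by ext <;> simp; abel)
    (fun c g w => by ext <;> simp [smul_comm c])
    (fun g v w => by ext <;> simp [add_smul]; abel)
    (fun c g w => by ext <;> simp [mul_smul])

theorem rep_apply (g : G) (w : G × ℝ) : S.rep g w = (⁅g, w.1⁆ + w.2 • S.degree g, 0) := rfl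

theorem rep_lie (g h : G) : S.rep ⁅g, h⁆ = ⁅S.rep g, S.rep h⁆ := by
  refine LinearMap.ext fun w => ?_
  rw [LieRing.of_associative_ring_bracket, LinearMap.sub_apply, Module.End.mul_apply,
    Module.End.mul_apply]
  simp only [rep_apply, degree_lie, lie_add, lie_smul, lie_lie, zero_smul, smul_add]
  ext
  · simp only [Prod.fst_sub]
    rw [← lie_skew h (S.degree g)]
    simp only [smul_neg]
    abel
  · simp

/-- The adjoint representation of `G` alone kills the centre. The extra coordinate detects it: `rep
g (0, 1)` has first component `degree g`, and `degree` is injective as all weights are positive. -/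
theorem rep_injective : Function.Injective S.rep := by
  refine (injective_iff_map_eq_zero S.rep).mpr fun g hg => ?_
  have h := congrArg (fun f : Module.End ℝ (G × ℝ) => (f (0, 1)).1) hg
  simp only [rep_apply, lie_zero, one_smul, zero_add, LinearMap.zero_apply, Prod.fst_zero] at h
  exact S.degree_injective (h.trans (map_zero _).symm)

theorem prod_map_rep_apply (l : List G) (hl : l ≠ []) (w : G × ℝ) :
    ((l.map S.rep).prod w).1 ∈ S.filtration l.length ∧ ((l.map S.rep).prod w).2 = 0 := by
  match l with
  | [] => exact absurd rfl hl
  | [x] =>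
    simp only [List.map_cons, List.map_nil, List.prod_singleton, rep_apply]
    exact ⟨S.mem_filtration_one _, trivial⟩
  | x :: y :: l =>
    have ih := prod_map_rep_apply (y :: l) (by simp) w
    rw [List.map_cons, List.prod_cons, Module.End.mul_apply, rep_apply, ih.2, zero_smul, add_zero]
    exact ⟨S.lie_mem_filtration x ih.1, rfl⟩

theorem wordsVanish_rep (x y : G) : WordsVanish S.step (S.rep x) (S.rep y) := by
  intro l hl hlen
  have key : ∃ m : List G, l = m.map S.rep := by
    clear hlen
    induction l with
    | nil => exact ⟨[], rfl⟩
    | cons z l ih =>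
      obtain ⟨m, rfl⟩ := ih fun x hx => hl x (List.mem_cons_of_mem _ hx)
      rcases hl z (by simp) with rfl | rfl
      · exact ⟨x :: m, rfl⟩
      · exact ⟨y :: m, rfl⟩
  obtain ⟨m, rfl⟩ := key
  rw [List.length_map] at hlen
  refine LinearMap.ext fun w => ?_
  have h := S.prod_map_rep_apply m (by rintro rfl; simp at hlen) w
  exact Prod.ext (S.eq_zero_of_mem_filtration hlen h.1) h.2

theorem rep_pow_eq_zero (x : G) {m : ℕ} (hm : S.step < m) : S.rep x ^ m = 0 :=
  (S.wordsVanish_rep x x).pow_left hm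

theorem mul_eq_sum_step (x y : G) :
    S.mul x y = ∑ n ∈ Finset.Icc 1 S.step, ∑ p ∈ bchIndex S.step n,
      (logCoeff p / (pairDegree p : ℝ)) • nestedBracket (pairWord x y p) := by
  refine Finset.sum_congr rfl fun n _ => ?_
  refine Finset.sum_bij (fun p _ i => (((p i).1 : ℕ), ((p i).2 : ℕ))) ?_ ?_ ?_ ?_
  · intro p hp
    rw [Finset.mem_filter] at hp
    rw [mem_bchIndex]
    exact fun i => ⟨⟨Nat.lt_succ_iff.mp (p i).1.2, Nat.lt_succ_iff.mp (p i).2.2⟩, hp.2 i⟩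
  · intro p _ q _ h
    funext i
    have := congrFun h i
    rw [Prod.mk.injEq] at this
    exact Prod.ext (Fin.ext this.1) (Fin.ext this.2)
  · intro q hq
    rw [mem_bchIndex] at hq
    refine ⟨fun i => (⟨(q i).1, Nat.lt_succ_iff.mpr (hq i).1.1⟩,
      ⟨(q i).2, Nat.lt_succ_iff.mpr (hq i).1.2⟩), ?_, rfl⟩
    rw [Finset.mem_filter]
    exact ⟨Finset.mem_univ _, fun i => (hq i).2⟩
  · intro p _
    congr 1
    rw [logCoeff, pairDegree]
    push_cast
    rw [div_right_comm, div_eq_mul_inv _ (∏ i, _), ← Finset.prod_inv_distrib]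
    simp only [mul_inv]

/-- Brackets of more than `step` letters vanish, so the ranges may be enlarged to the `K` for which
the associative formula is known. -/
theorem mul_eq_sum {K : ℕ} (hK : S.step ≤ K) (x y : G) :
    S.mul x y = ∑ n ∈ Finset.Icc 1 K, ∑ p ∈ bchIndex K n,
      (logCoeff p / (pairDegree p : ℝ)) • nestedBracket (pairWord x y p) := by
  have hvan : ∀ n (p : Fin n → ℕ × ℕ), S.step < pairDegree p →
      nestedBracket (pairWord x y p) = 0 := by
    intro n p hp
    refine S.eq_zero_of_mem_filtration hp ?_
    rw [← length_pairWord x y p]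
    exact S.nestedBracket_mem_filtration _
  rw [mul_eq_sum_step]
  have h1 : ∀ n, ∑ p ∈ bchIndex S.step n,
      (logCoeff p / (pairDegree p : ℝ)) • nestedBracket (pairWord x y p) =
      ∑ p ∈ bchIndex K n,
        (logCoeff p / (pairDegree p : ℝ)) • nestedBracket (pairWord x y p) := by
    intro n
    refine Finset.sum_subset ?_ ?_
    · intro p hp
      rw [mem_bchIndex] at hp ⊢
      exact fun i => ⟨⟨(hp i).1.1.trans hK, (hp i).1.2.trans hK⟩, (hp i).2⟩
    · intro p hp hp'
      rw [hvan n p, smul_zero]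
      by_contra hlt
      rw [not_lt] at hlt
      rw [mem_bchIndex] at hp hp'
      have hle : ∀ i, (p i).1 + (p i).2 ≤ pairDegree p := fun i =>
        Finset.single_le_sum (f := fun i => (p i).1 + (p i).2) (fun _ _ => Nat.zero_le _)
          (Finset.mem_univ i)
      exact hp' fun i => ⟨⟨by have := hle i; omega, by have := hle i; omega⟩, (hp i).2⟩
  simp only [h1]
  refine Finset.sum_subset (Finset.Icc_subset_Icc_right hK) fun n hn hn' => ?_
  refine Finset.sum_eq_zero fun p hp => ?_
  rw [hvan n p, smul_zero]
  have := le_pairDegree hp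
  rw [Finset.mem_Icc] at hn hn'
  omega

/-- Dynkin's formula among endomorphisms identifies `rep (mul x y)` with `log (exp (rep x) exp (rep
y))`. Since `rep` is injective and the exponential can be inverted, the group axioms follow from
those for composition. -/
theorem truncExp_rep_mul (x y : G) :
    ∀ᶠ K : ℕ in Filter.atTop,
      truncExp K (S.rep (S.mul x y)) = truncExp K (S.rep x) * truncExp K (S.rep y) := by
  filter_upwards [eventually_truncLog_eq_dynkin (S.wordsVanish_rep x y),
    Filter.eventually_ge_atTop S.step] with K hK hstep
  have h : S.rep (S.mul x y) =
      truncLog K (truncExp K (S.rep x) * truncExp K (S.rep y) - 1) := by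
    rw [hK, S.mul_eq_sum hstep, map_sum]
    refine Finset.sum_congr rfl fun n _ => ?_
    rw [map_sum]
    refine Finset.sum_congr rfl fun p _ => ?_
    rw [map_smul, map_nestedBracket S.rep (map_zero _) S.rep_lie, pairWord_map]
  rw [h, truncExp_truncLog ((S.wordsVanish_rep x y).truncExp_mul_sub_one_pow K (by omega)),
    add_sub_cancel]

theorem eq_of_truncExp_rep {K : ℕ} (hK : S.step ≤ K) {x y : G}
    (h : truncExp K (S.rep x) = truncExp K (S.rep y)) : x = y := by
  apply S.rep_injective
  rw [← truncLog_truncExp (S.rep_pow_eq_zero x (Nat.lt_succ_iff.mpr hK)), h,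
    truncLog_truncExp (S.rep_pow_eq_zero y (Nat.lt_succ_iff.mpr hK))]

theorem mul_assoc' (x y z : G) : S.mul (S.mul x y) z = S.mul x (S.mul y z) := by
  obtain ⟨K, hK, h1, h2, h3, h4⟩ := ((Filter.eventually_ge_atTop S.step).and
    ((S.truncExp_rep_mul (S.mul x y) z).and ((S.truncExp_rep_mul x y).and
    ((S.truncExp_rep_mul x (S.mul y z)).and (S.truncExp_rep_mul y z))))).exists
  refine S.eq_of_truncExp_rep hK ?_
  rw [h1, h2, h3, h4, mul_assoc]

theorem mul_zero' (x : G) : S.mul x 0 = x := by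
  obtain ⟨K, hK, h1⟩ := ((Filter.eventually_ge_atTop S.step).and
    (S.truncExp_rep_mul x 0)).exists
  refine S.eq_of_truncExp_rep hK ?_
  rw [h1, map_zero, truncExp_zero, mul_one]

theorem zero_mul' (x : G) : S.mul 0 x = x := by
  obtain ⟨K, hK, h1⟩ := ((Filter.eventually_ge_atTop S.step).and
    (S.truncExp_rep_mul 0 x)).exists
  refine S.eq_of_truncExp_rep hK ?_
  rw [h1, map_zero, truncExp_zero, one_mul]

theorem neg_mul_self (x : G) : S.mul (-x) x = 0 := by
  obtain ⟨K, hK, h1⟩ := ((Filter.eventually_ge_atTop S.step).and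
    (S.truncExp_rep_mul (-x) x)).exists
  refine S.eq_of_truncExp_rep hK ?_
  rw [h1, map_neg, map_zero, truncExp_zero,
    truncExp_neg_mul_self (S.rep_pow_eq_zero x (Nat.lt_succ_iff.mpr hK))]

theorem mul_neg_self (x : G) : S.mul x (-x) = 0 := by
  simpa using S.neg_mul_self (-x)

theorem neg_mul_cancel_left (x y : G) : S.mul (-x) (S.mul x y) = y := by
  rw [← mul_assoc', neg_mul_self, zero_mul']

theorem mul_neg_cancel_left (x y : G) : S.mul x (S.mul (-x) y) = y := by
  rw [← mul_assoc', mul_neg_self, zero_mul']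

theorem neg_mul_rev (x y : G) : -(S.mul x y) = S.mul (-y) (-x) := by
  have h : S.mul (S.mul x y) (S.mul (-y) (-x)) = 0 := by
    rw [mul_assoc', mul_neg_cancel_left, mul_neg_self]
  rw [← S.neg_mul_cancel_left (S.mul x y) (S.mul (-y) (-x)), h, mul_zero']

theorem dilation_mul (t : ℝ) (x y : G) :
    S.dilation t (S.mul x y) = S.mul (S.dilation t x) (S.dilation t y) := by
  have h0 : S.dilation t 0 = 0 := by rw [dilation_eq_layerScale, map_zero]
  rw [mul_eq_sum_step, mul_eq_sum_step, dilation_eq_layerScale]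
  simp only [map_sum, map_smul]
  refine Finset.sum_congr rfl fun n _ => Finset.sum_congr rfl fun p _ => ?_
  rw [← dilation_eq_layerScale, map_nestedBracket (S.dilation t) h0 (S.dilation_lie t),
    pairWord_map]

end Stratification

/-! ### Dilations, Jacobians and the invariance of Lebesgue measure -/

namespace Stratification

section Algebra

variable {G : Type*} [LieRing G] [LieAlgebra ℝ G] (S : Stratification G)

theorem dilation_dilation (s t : ℝ) (x : G) :
    S.dilation s (S.dilation t x) = S.dilation (s * t) x := by
  simp only [dilation_eq_layerScale, layerScale_mul, mul_pow]

theorem dilation_one (x : G) : S.dilation 1 x = x := by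
  rw [dilation_eq_layerScale]
  exact S.layerScale_eq_self (fun j _ => one_pow j) x

theorem dilation_zero_left (x : G) : S.dilation 0 x = 0 := by
  rw [dilation]
  refine Finset.sum_eq_zero fun j hj => ?_
  rw [zero_pow (by rw [Finset.mem_Icc] at hj; omega), zero_smul]

end Algebra

section Determinant

variable {G : Type*} [LieRing G] [LieAlgebra ℝ G] [FiniteDimensional ℝ G] (S : Stratification G)

theorem det_layerScale (c : ℕ → ℝ) :
    LinearMap.det (S.layerScale c) =
      ∏ j ∈ Finset.Icc 1 S.step, c j ^ Module.finrank ℝ (S.layer j) := by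
  classical
  let b := S.isInternal.collectedBasis fun j => Module.finBasis ℝ (S.layer j)
  let _ : Fintype (Σ j : ℕ, Fin (Module.finrank ℝ (S.layer j))) :=
    FiniteDimensional.fintypeBasisIndex b
  have hb : LinearMap.toMatrix b b (S.layerScale c) = Matrix.diagonal fun i => c i.1 := by
    ext i k
    rw [LinearMap.toMatrix_apply,
      S.layerScale_of_mem c (S.isInternal.collectedBasis_mem _ k), map_smul, Finsupp.smul_apply,
      Module.Basis.repr_self, Matrix.diagonal_apply, Finsupp.single_apply]
    by_cases h : i = k
    · subst h; simp
    · simp [h, Ne.symm h]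
  rw [← LinearMap.det_toMatrix b, hb, Matrix.det_diagonal]
  have huniv : (Finset.univ : Finset (Σ j : ℕ, Fin (Module.finrank ℝ (S.layer j)))) =
      (Finset.Icc 1 S.step).sigma fun _ => Finset.univ := by
    ext ⟨j, i⟩
    simp only [Finset.mem_univ, Finset.mem_sigma, and_true, true_iff]
    by_contra hj
    have h0 : S.layer j = ⊥ := by
      rw [eq_bot_iff]
      intro x hx
      rw [S.mem_layer_eq_zero hj hx]
      exact Submodule.zero_mem _
    have : Module.finrank ℝ (S.layer j) = 0 := by rw [h0, finrank_bot]
    rw [this] at i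
    exact i.elim0
  rw [huniv, Finset.prod_sigma]
  simp

theorem det_dilation (t : ℝ) :
    LinearMap.det (S.layerScale fun j => t ^ j) = t ^ S.homDim := by
  rw [det_layerScale, homDim, ← Finset.prod_pow_eq_pow_sum]
  exact Finset.prod_congr rfl fun j _ => (pow_mul t j _).symm

end Determinant

section Topology

theorem _root_.ContinuousLinearEquiv.map_apply_eq {G E : Type*} [AddCommGroup G] [Module ℝ G]
    [TopologicalSpace G] [MeasurableSpace G] [BorelSpace G] [AddCommGroup E] [Module ℝ E]
    [TopologicalSpace E] [MeasurableSpace E] [BorelSpace E] (μ : Measure G) (e : G ≃L[ℝ] E)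
    (A : Set E) : (μ.map e) A = μ (e ⁻¹' A) :=
  e.toHomeomorph.toMeasurableEquiv.map_apply A

variable {G : Type*} [LieRing G] [LieAlgebra ℝ G] [FiniteDimensional ℝ G]
  [TopologicalSpace G] [IsTopologicalAddGroup G] [ContinuousSMul ℝ G] [T2Space G]
  {E : Type*} [NormedAddCommGroup E] [NormedSpace ℝ E] [FiniteDimensional ℝ E]
  (S : Stratification G)

theorem continuous_dilation : Continuous fun p : ℝ × G => S.dilation p.1 p.2 := by
  unfold dilation
  refine continuous_finsetSum _ fun j _ => (continuous_fst.pow j).smul ?_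
  exact (S.componentLM j).continuous_of_finiteDimensional.comp continuous_snd

/-- The group law in linear coordinates. -/
def coordMul (e : G ≃L[ℝ] E) (p : E × E) : E := e (S.mul (e.symm p.1) (e.symm p.2))

/-- Words are coded by lists of booleans so that an induction on the word can keep both arguments
variable. -/
theorem contDiff_nestedBracket {G : Type*} [LieRing G] [LieAlgebra ℝ G] [TopologicalSpace G]
    (e : G ≃L[ℝ] E) (l : List Bool) :
    ContDiff ℝ 1 fun p : E × E =>
      e (nestedBracket (l.map fun b => if b then e.symm p.1 else e.symm p.2)) := by
  have hletter : ∀ b : Bool, ContDiff ℝ 1 fun p : E × E => if b then p.1 else p.2 := by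
    intro b
    cases b
    · simpa using contDiff_snd
    · simpa using contDiff_fst
  have hif : ∀ (b : Bool) (p : E × E),
      (if b then e.symm p.1 else e.symm p.2) = e.symm (if b then p.1 else p.2) := by
    intro b p; cases b <;> simp
  match l with
  | [] => simpa [nestedBracket] using contDiff_const
  | [b] => simpa [nestedBracket, hif] using hletter b
  | b :: c :: l =>
    have ih := contDiff_nestedBracket e (c :: l)
    let B : E →L[ℝ] E →L[ℝ] E := LinearMap.toContinuousBilinearMap
      ((((bracketLM G).compr₂ e.toLinearMap).compl₂ e.symm.toLinearMap) ∘ₗ e.symm.toLinearMap)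
    have hB : ∀ u v : E, B u v = e ⁅e.symm u, e.symm v⁆ := fun u v => rfl
    have h := (B.contDiff.comp (hletter b)).clm_apply ih
    convert h using 1
    funext p
    simp only [Function.comp_apply]
    rw [hB, e.symm_apply_apply, ← hif]
    rfl

theorem contDiff_coordMul {G : Type*} [LieRing G] [LieAlgebra ℝ G] [TopologicalSpace G]
    (S : Stratification G) (e : G ≃L[ℝ] E) : ContDiff ℝ 1 (S.coordMul e) := by
  unfold coordMul
  simp only [mul_eq_sum_step, map_sum, map_smul]
  refine ContDiff.sum fun n _ => ContDiff.sum fun p _ => ContDiff.const_smul _ ?_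
  have h := contDiff_nestedBracket e (pairWord true false p)
  simpa only [pairWord_map, if_true, Bool.false_eq_true, if_false] using h

theorem continuous_mul : Continuous fun p : G × G => S.mul p.1 p.2 := by
  let e := toEuclidean (E := G)
  have h : Continuous fun p : G × G => e.symm (S.coordMul e (e p.1, e p.2)) :=
    e.symm.continuous.comp ((S.contDiff_coordMul e).continuous.comp
      ((e.continuous.comp continuous_fst).prodMk (e.continuous.comp continuous_snd)))
  simpa [coordMul] using h

/-- Left translations have Jacobian determinant `1`: the determinant is continuous in the pair of
arguments and invariant under dilations. -/
theorem det_fderiv_coordMul (e : G ≃L[ℝ] E) (a x : E) :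
    ((fderiv ℝ (S.coordMul e) (a, x)).comp (ContinuousLinearMap.inr ℝ E E)).det = 1 := by
  set J : E × E → ℝ := fun p =>
    ((fderiv ℝ (S.coordMul e) p).comp (ContinuousLinearMap.inr ℝ E E)).det with hJ
  have hdiff : Differentiable ℝ (S.coordMul e) :=
    (S.contDiff_coordMul e).differentiable (by simp)
  have hJc : Continuous J := ContinuousLinearMap.continuous_det.comp
    (((S.contDiff_coordMul e).continuous_fderiv (by simp)).clm_comp continuous_const)
  have hpart : ∀ u v : E, HasFDerivAt (fun y => S.coordMul e (u, y))
      ((fderiv ℝ (S.coordMul e) (u, v)).comp (ContinuousLinearMap.inr ℝ E E)) v := fun u v =>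
    (hdiff (u, v)).hasFDerivAt.comp v (hasFDerivAt_prodMk_right u v)
  have hJ0 : J (0, 0) = 1 := by
    have h1 : HasFDerivAt (fun y : E => y)
        ((fderiv ℝ (S.coordMul e) (0, 0)).comp (ContinuousLinearMap.inr ℝ E E)) 0 := by
      have := hpart 0 0
      simpa [coordMul, zero_mul'] using this
    have h2 := h1.unique (hasFDerivAt_id (0 : E))
    simp only [hJ]
    rw [h2]
    simp [ContinuousLinearMap.det]
  let D : ℝ → E →L[ℝ] E := fun t => LinearMap.toContinuousLinearMap
    (e.toLinearEquiv.toLinearMap ∘ₗ (S.layerScale fun j => t ^ j) ∘ₗ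
      e.toLinearEquiv.symm.toLinearMap)
  have hD : ∀ t u, D t u = e (S.dilation t (e.symm u)) := fun t u => by
    rw [dilation_eq_layerScale]; rfl
  have hDdet : ∀ t, (D t).det = t ^ S.homDim := fun t => by
    rw [← det_dilation]
    exact LinearMap.det_conj _ e.toLinearEquiv
  -- Dilations are automorphisms, so translation by `δ_t a` composed with `δ_t` equals `δ_t`
  -- composed with translation by `a`. In the chain rule `det δ_t ≠ 0` cancels.
  have hinv : ∀ t : ℝ, 0 < t → J (D t a, D t x) = J (a, x) := by
    intro t ht
    have h1 : (fun y => S.coordMul e (D t a, D t y)) = fun y => D t (S.coordMul e (a, y)) := by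
      funext y
      simp only [coordMul, hD, e.symm_apply_apply, dilation_mul]
    have h2 := (hpart (D t a) (D t x)).comp x (D t).hasFDerivAt
    have h3 := (D t).hasFDerivAt.comp x (hpart a x)
    have h4 : HasFDerivAt (fun y => S.coordMul e (D t a, D t y)) _ x := h2
    rw [h1] at h4
    have h5 := congrArg ContinuousLinearMap.det (h4.unique h3)
    simp only [ContinuousLinearMap.det, ContinuousLinearMap.toLinearMap_comp] at h5
    rw [LinearMap.det_comp, LinearMap.det_comp, mul_comm] at h5
    have hne : LinearMap.det (D t : E →ₗ[ℝ] E) ≠ 0 := by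
      have := hDdet t
      rw [ContinuousLinearMap.det] at this
      rw [this]
      exact (pow_pos ht _).ne'
    have h6 := mul_left_cancel₀ hne h5
    simpa only [hJ, ContinuousLinearMap.det, ContinuousLinearMap.toLinearMap_comp,
      LinearMap.det_comp] using h6
  have hcont : ∀ u : E, Continuous fun t => D t u := fun u => by
    simp only [hD]
    exact e.continuous.comp (S.continuous_dilation.comp (Continuous.prodMk_left _))
  -- As `t → 0` both arguments shrink to `0`, every layer having positive weight, and there the
  -- translation is the identity.
  have hlim : Filter.Tendsto (fun t => J (D t a, D t x)) (nhdsWithin 0 (Ioi 0))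
      (nhds (J (D 0 a, D 0 x))) :=
    ((hJc.comp ((hcont a).prodMk (hcont x))).tendsto 0).mono_left nhdsWithin_le_nhds
  have h0 : ∀ u, D 0 u = 0 := fun u => by rw [hD, dilation_zero_left, map_zero]
  rw [h0, h0, hJ0] at hlim
  have hconst : Filter.Tendsto (fun t => J (D t a, D t x)) (nhdsWithin 0 (Ioi 0))
      (nhds (J (a, x))) :=
    tendsto_const_nhds.congr' (by
      filter_upwards [self_mem_nhdsWithin] with t ht
      exact (hinv t ht).symm)
  exact tendsto_nhds_unique hconst hlim

variable [MeasurableSpace G] [BorelSpace G] (μ : Measure G) [μ.IsAddHaarMeasure]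

theorem measure_preimage_mul_left (a : G) {A : Set G} (hA : MeasurableSet A) :
    μ ((fun x => S.mul a x) ⁻¹' A) = μ A := by
  let E := EuclideanSpace ℝ (Fin (Module.finrank ℝ G))
  let e : G ≃L[ℝ] E := toEuclidean
  have _ : (μ.map e).IsAddHaarMeasure := e.isAddHaarMeasure_map μ
  have hdiff : Differentiable ℝ (S.coordMul e) :=
    (S.contDiff_coordMul e).differentiable (by simp)
  have hA' : MeasurableSet (e.symm ⁻¹' A) := e.symm.continuous.measurable hA
  -- The change of variables is applied to `x ↦ a⁻¹ x`, because its image of `A` is the preimage of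
  -- `A` under translation by `a`.
  have key := lintegral_abs_det_fderiv_eq_addHaar_image (μ.map e) hA'
    (f := fun y => S.coordMul e (e (-a), y))
    (f' := fun x => (fderiv ℝ (S.coordMul e) (e (-a), x)).comp (ContinuousLinearMap.inr ℝ E E))
    (fun x _ => ((hdiff (e (-a), x)).hasFDerivAt.comp x
      (hasFDerivAt_prodMk_right (e (-a)) x)).hasFDerivWithinAt)
    (fun x _ y _ hxy => by
      simp only [coordMul, e.symm_apply_apply] at hxy
      have h1 := congrArg (S.mul a) (e.injective hxy)
      rw [mul_neg_cancel_left, mul_neg_cancel_left] at h1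
      exact e.symm.injective h1)
  simp only [det_fderiv_coordMul, abs_one, ENNReal.ofReal_one, lintegral_one,
    Measure.restrict_apply_univ] at key
  rw [e.map_apply_eq, e.map_apply_eq] at key
  have h1 : e ⁻¹' (e.symm ⁻¹' A) = A := by ext x; simp
  have h2 : e ⁻¹' ((fun y => S.coordMul e (e (-a), y)) '' (e.symm ⁻¹' A)) =
      (fun x => S.mul a x) ⁻¹' A := by
    ext x
    simp only [mem_preimage, mem_image, coordMul, e.symm_apply_apply]
    constructor
    · rintro ⟨y, hy, hyx⟩
      rw [← e.injective hyx, mul_neg_cancel_left]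
      exact hy
    · intro hx
      exact ⟨e (S.mul a x), by simpa using hx, by simp [neg_mul_cancel_left]⟩
  rw [h1, h2] at key
  exact key.symm

theorem measure_preimage_dilation {t : ℝ} (ht : 0 < t) (A : Set G) :
    μ (S.dilation t ⁻¹' A) = ENNReal.ofReal ((t ^ S.homDim)⁻¹) * μ A := by
  let E := EuclideanSpace ℝ (Fin (Module.finrank ℝ G))
  let e : G ≃L[ℝ] E := toEuclidean
  have _ : (μ.map e).IsAddHaarMeasure := e.isAddHaarMeasure_map μ
  let D : E →ₗ[ℝ] E := e.toLinearEquiv.toLinearMap ∘ₗ (S.layerScale fun j => t ^ j) ∘ₗ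
      e.toLinearEquiv.symm.toLinearMap
  have hdet : LinearMap.det D = t ^ S.homDim := by
    rw [← det_dilation]
    exact LinearMap.det_conj _ e.toLinearEquiv
  have hD : ∀ u, D u = e (S.dilation t (e.symm u)) := fun u => by
    rw [dilation_eq_layerScale]; rfl
  have hpos : 0 < t ^ S.homDim := pow_pos ht _
  have key := Measure.addHaar_preimage_linearMap (μ.map e) (f := D)
    (by rw [hdet]; exact hpos.ne') (e.symm ⁻¹' A)
  rw [hdet, abs_of_pos (inv_pos.mpr hpos), e.map_apply_eq, e.map_apply_eq] at key
  have h1 : e ⁻¹' (e.symm ⁻¹' A) = A := by ext x; simp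
  have h2 : e ⁻¹' (D ⁻¹' (e.symm ⁻¹' A)) = S.dilation t ⁻¹' A := by
    ext x
    simp [hD]
  rwa [h1, h2] at key

end Topology

end Stratification

/-! ### Homogeneous norms and the measure of balls -/

namespace HomogeneousNorm

variable {G : Type*} [LieRing G] [LieAlgebra ℝ G] [TopologicalSpace G]
  {S : Stratification G} (ρ : HomogeneousNorm S)

theorem map_zero : ρ.toFun 0 = 0 := (ρ.eq_zero_iff 0).mpr rfl

theorem dist_comm (g h : G) : ρ.dist g h = ρ.dist h g := by
  rw [dist, dist, ← ρ.inv, S.neg_mul_rev, neg_neg]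

theorem dist_triangle (g h k : G) : ρ.dist g k ≤ ρ.dist g h + ρ.dist h k := by
  have h1 := ρ.subadd (S.mul (-g) h) (S.mul (-h) k)
  rwa [S.mul_assoc', S.mul_neg_cancel_left] at h1

theorem dist_zero_left (h : G) : ρ.dist 0 h = ρ.toFun h := by
  rw [dist, neg_zero, S.zero_mul']

theorem exists_pos_le_of_norm_eq_one {E : Type*} [NormedAddCommGroup E]
    [NormedSpace ℝ E] [FiniteDimensional ℝ E] (e : G ≃L[ℝ] E) :
    ∃ m : ℝ, 0 < m ∧ ∀ u : E, ‖u‖ = 1 → m ≤ ρ.toFun (e.symm u) := by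
  have _ : ProperSpace E := FiniteDimensional.proper ℝ E
  have hpos : ∀ u ∈ Metric.sphere (0 : E) 1, 0 < ρ.toFun (e.symm u) := by
    intro u hu
    refine lt_of_le_of_ne (ρ.nonneg _) fun h => ?_
    have h1 := (ρ.eq_zero_iff _).mp h.symm
    rw [e.symm.map_eq_zero_iff] at h1
    rw [h1] at hu
    simp at hu
  obtain ⟨m, hm, hmin⟩ := (isCompact_sphere (0 : E) 1).exists_forall_le'
    (ρ.continuous.comp e.symm.continuous).continuousOn hpos
  exact ⟨m, hm, fun u hu => hmin u (by simpa using hu)⟩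

theorem measure_unitBall_pos [MeasurableSpace G] (μ : Measure G) [μ.IsOpenPosMeasure] : 0 < μ {x | ρ.toFun x < 1} :=
  (isOpen_lt ρ.continuous continuous_const).measure_pos μ ⟨0, by simp [ρ.map_zero]⟩

theorem measure_unitClosedBall_pos [MeasurableSpace G] (μ : Measure G)
    [μ.IsOpenPosMeasure] : 0 < μ {x | ρ.toFun x ≤ 1} :=
  (ρ.measure_unitBall_pos μ).trans_le (measure_mono fun _ (hx : ρ.toFun _ < 1) => hx.le)

theorem toFun_dilation_inv {r : ℝ} (hr : 0 < r) (x : G) :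
    ρ.toFun (S.dilation r⁻¹ x) = ρ.toFun x / r := by
  rw [ρ.homogeneous _ (inv_pos.mpr hr), inv_mul_eq_div]

variable [FiniteDimensional ℝ G] [IsTopologicalAddGroup G] [ContinuousSMul ℝ G] [T2Space G]

theorem continuous_dist : Continuous fun p : G × G => ρ.dist p.1 p.2 := by
  have h : Continuous fun p : G × G => (-p.1, p.2) := continuous_fst.neg.prodMk continuous_snd
  have h2 := ρ.continuous.comp (S.continuous_mul.comp h)
  unfold dist
  exact h2

/-- Dilate a point with `ρ ≤ 1` outside the Euclidean unit ball until it reaches the unit sphere, on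
which `ρ ≥ m`. By homogeneity the factor `t` lies in `[m, 1]`, so the point belongs to the image of
a compact set under `(t, u) ↦ δ_{1/t} u`. -/
theorem exists_isCompact_unitClosedBall_subset {E : Type*} [NormedAddCommGroup E]
    [NormedSpace ℝ E] [FiniteDimensional ℝ E] (e : G ≃L[ℝ] E) :
    ∃ K : Set G, IsCompact K ∧ {x | ρ.toFun x ≤ 1} ⊆ K := by
  have _ : ProperSpace E := FiniteDimensional.proper ℝ E
  obtain ⟨m, hm, hmin⟩ := ρ.exists_pos_le_of_norm_eq_one e
  refine ⟨(e.symm '' Metric.closedBall 0 1) ∪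
    (fun p : ℝ × E => S.dilation p.1⁻¹ (e.symm p.2)) '' (Icc m 1 ×ˢ Metric.sphere 0 1),
    ((isCompact_closedBall _ _).image e.symm.continuous).union
      ((isCompact_Icc.prod (isCompact_sphere _ _)).image_of_continuousOn ?_), fun x hx => ?_⟩
  · refine S.continuous_dilation.comp_continuousOn (ContinuousOn.prodMk ?_ ?_)
    · refine continuous_fst.continuousOn.inv₀ fun p hp => ?_
      exact (hm.trans_le hp.1.1).ne'
    · exact (e.symm.continuous.comp continuous_snd).continuousOn
  · by_cases hx1 : ‖e x‖ ≤ 1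
    · left
      exact ⟨e x, by simpa using hx1, by simp⟩
    · right
      rw [not_le] at hx1
      have hcont : Continuous fun t : ℝ => ‖e (S.dilation t x)‖ :=
        (e.continuous.comp (S.continuous_dilation.comp (Continuous.prodMk_left x))).norm
      obtain ⟨t, ht, hte⟩ := intermediate_value_Icc (zero_le_one' ℝ) hcont.continuousOn
        (show (1 : ℝ) ∈ Icc _ _ by
          simp only [S.dilation_zero_left, S.dilation_one, _root_.map_zero, norm_zero]
          exact ⟨zero_le_one, hx1.le⟩)
      have ht0 : 0 < t := by
        refine lt_of_le_of_ne ht.1 fun h => ?_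
        rw [← h] at hte
        simp [S.dilation_zero_left] at hte
      have hmt : m ≤ t := by
        have h1 := hmin (e (S.dilation t x)) hte
        rw [e.symm_apply_apply, ρ.homogeneous t ht0] at h1
        calc m ≤ t * ρ.toFun x := h1
          _ ≤ t * 1 := by gcongr; exact hx
          _ = t := mul_one t
      refine ⟨(t, e (S.dilation t x)), ⟨⟨hmt, ht.2⟩, by simpa using hte⟩, ?_⟩
      simp [S.dilation_dilation, inv_mul_cancel₀ ht0.ne', S.dilation_one]

theorem measure_unitClosedBall_lt_top [MeasurableSpace G] (μ : Measure G)
    [IsFiniteMeasureOnCompacts μ] : μ {x | ρ.toFun x ≤ 1} < ∞ := by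
  obtain ⟨K, hK, hsub⟩ := ρ.exists_isCompact_unitClosedBall_subset toEuclidean
  exact (measure_mono hsub).trans_lt hK.measure_lt_top

variable [MeasurableSpace G] [BorelSpace G] (μ : Measure G) [μ.IsAddHaarMeasure]

theorem measure_closedBall (g : G) {r : ℝ} (hr : 0 < r) :
    μ {h | ρ.dist g h ≤ r} = ENNReal.ofReal (r ^ S.homDim) * μ {x | ρ.toFun x ≤ 1} := by
  have h1 : {h | ρ.dist g h ≤ r} = (fun x => S.mul (-g) x) ⁻¹' {x | ρ.toFun x ≤ r} := rfl
  have h2 : {x | ρ.toFun x ≤ r} = S.dilation r⁻¹ ⁻¹' {x | ρ.toFun x ≤ 1} := by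
    ext x
    simp only [mem_ofPred_eq, mem_preimage, ρ.toFun_dilation_inv hr, div_le_one hr]
  rw [h1, S.measure_preimage_mul_left μ _ (isClosed_le ρ.continuous continuous_const).measurableSet,
    h2, S.measure_preimage_dilation μ (inv_pos.mpr hr)]
  simp

theorem measure_ball_zero {r : ℝ} (hr : 0 < r) :
    μ (ρ.ball 0 r) = ENNReal.ofReal (r ^ S.homDim) * μ {x | ρ.toFun x < 1} := by
  have h2 : ρ.ball 0 r = S.dilation r⁻¹ ⁻¹' {x | ρ.toFun x < 1} := by
    ext x
    simp only [ball, mem_ofPred_eq, mem_preimage, ρ.toFun_dilation_inv hr, div_lt_one hr,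
      ρ.dist_zero_left]
  rw [h2, S.measure_preimage_dilation μ (inv_pos.mpr hr)]
  simp

end HomogeneousNorm

/-! ### From distributional inequalities to `L¹` bounds -/

section LayerCake

theorem lintegral_Ioi_indicator_lt (u : ℝ≥0∞) :
    ∫⁻ l in Ioi (0 : ℝ), {l : ℝ | ENNReal.ofReal l < u}.indicator 1 l = u := by
  have hm : MeasurableSet {l : ℝ | ENNReal.ofReal l < u} :=
    measurableSet_lt ENNReal.measurable_ofReal measurable_const
  rw [lintegral_indicator_one hm, Measure.restrict_apply hm]
  rcases eq_or_ne u ∞ with rfl | hu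
  · simp [ENNReal.ofReal_lt_top]
  · have : {l : ℝ | ENNReal.ofReal l < u} ∩ Ioi 0 = Ioo 0 u.toReal := by
      ext l
      constructor
      · rintro ⟨h1, h2⟩
        exact ⟨h2, (ENNReal.ofReal_lt_iff_lt_toReal (le_of_lt h2) hu).mp h1⟩
      · rintro ⟨h1, h2⟩
        exact ⟨(ENNReal.ofReal_lt_iff_lt_toReal h1.le hu).mpr h2, h1⟩
    rw [this, Real.volume_Ioo, sub_zero, ENNReal.ofReal_toReal hu]

/-- For finite `u > 0` this is `∫_u^∞ u² l⁻² dl = u`; at `u = ∞` the left side is `0`, hence only an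
inequality. -/
theorem lintegral_Ioi_inv_sq_le (u : ℝ≥0∞) :
    ∫⁻ l in Ioi (0 : ℝ), {l : ℝ | u ≤ ENNReal.ofReal l}.indicator
      (fun l => (ENNReal.ofReal l ^ 2)⁻¹ * u ^ 2) l ≤ u := by
  rcases eq_or_ne u ∞ with rfl | hu
  · exact le_top
  rcases eq_or_ne u 0 with rfl | hu0
  · simp
  lift u to NNReal using hu
  have ha : (0 : ℝ) < u := by
    have : u ≠ 0 := by exact_mod_cast hu0
    positivity
  set a : ℝ := NNReal.toReal u with hau
  have hm : MeasurableSet {l : ℝ | (u : ℝ≥0∞) ≤ ENNReal.ofReal l} :=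
    measurableSet_le measurable_const ENNReal.measurable_ofReal
  rw [lintegral_indicator hm, Measure.restrict_restrict hm]
  have hset : {l : ℝ | (u : ℝ≥0∞) ≤ ENNReal.ofReal l} ∩ Ioi 0 = Ici a := by
    ext l
    rw [← ENNReal.ofReal_coe_nnreal]
    constructor
    · rintro ⟨h1, h2⟩
      exact (ENNReal.ofReal_le_ofReal_iff (le_of_lt h2)).mp h1
    · intro h
      exact ⟨ENNReal.ofReal_le_ofReal h, ha.trans_le h⟩
  rw [hset, setLIntegral_congr Ioi_ae_eq_Ici.symm]
  have hint : IntegrableOn (fun l : ℝ => l ^ (-2 : ℝ)) (Ioi a) :=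
    integrableOn_Ioi_rpow_of_lt (by norm_num) ha
  have hval : ∫ l in Ioi a, l ^ (-2 : ℝ) = a⁻¹ := by
    rw [integral_Ioi_rpow_of_lt (by norm_num) ha]
    norm_num [Real.rpow_neg_one]
  have h1 : ∫⁻ l in Ioi a, (ENNReal.ofReal l ^ 2)⁻¹ * (u : ℝ≥0∞) ^ 2 =
      ∫⁻ l in Ioi a, ENNReal.ofReal (l ^ (-2 : ℝ)) * (u : ℝ≥0∞) ^ 2 := by
    refine setLIntegral_congr_fun measurableSet_Ioi fun l hl => ?_
    have hl0 : 0 < l := ha.trans hl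
    rw [Real.rpow_neg hl0.le, ENNReal.ofReal_inv_of_pos (Real.rpow_pos_of_pos hl0 _),
      show (2 : ℝ) = ((2 : ℕ) : ℝ) by norm_num, Real.rpow_natCast, ENNReal.ofReal_pow hl0.le]
  rw [h1, lintegral_mul_const' _ _ (by simp), ← ofReal_integral_eq_lintegral_ofReal hint, hval,
    ← ENNReal.ofReal_coe_nnreal, ← hau, ← ENNReal.ofReal_pow ha.le, ← ENNReal.ofReal_mul
      (by positivity)]
  · exact ENNReal.ofReal_le_ofReal (by field_simp; rfl)
  · filter_upwards [ae_restrict_mem measurableSet_Ioi] with l hl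
    exact Real.rpow_nonneg (ha.trans hl).le _

variable {X : Type*} [MeasurableSpace X] {μ : Measure X} [SFinite μ]

theorem lintegral_eq_lintegral_Ioi_meas_lt {u : X → ℝ≥0∞} (hu : Measurable u) :
    ∫⁻ x, u x ∂μ = ∫⁻ l in Ioi (0 : ℝ), μ {x | ENNReal.ofReal l < u x} := by
  have hm : MeasurableSet {p : X × ℝ | ENNReal.ofReal p.2 < u p.1} :=
    measurableSet_lt (ENNReal.measurable_ofReal.comp measurable_snd) (hu.comp measurable_fst)
  calc ∫⁻ x, u x ∂μ
      = ∫⁻ x, (∫⁻ l in Ioi (0 : ℝ), {l : ℝ | ENNReal.ofReal l < u x}.indicator 1 l) ∂μ :=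
        lintegral_congr fun x => (lintegral_Ioi_indicator_lt (u x)).symm
    _ = ∫⁻ l in Ioi (0 : ℝ), ∫⁻ x, {l : ℝ | ENNReal.ofReal l < u x}.indicator 1 l ∂μ := by
        refine lintegral_lintegral_swap ?_
        exact ((measurable_one (α := ℝ≥0∞)).indicator hm).aemeasurable
    _ = _ := by
        refine lintegral_congr fun l => ?_
        have hl : MeasurableSet {x | ENNReal.ofReal l < u x} := measurableSet_lt measurable_const hu
        rw [← lintegral_indicator_one hl]
        rfl

/-- A weak-type estimate with an `L²` error term implies an `L¹` estimate. -/
theorem lintegral_le_of_meas_lt_le {u v : X → ℝ≥0∞} (hu : Measurable u) (hv : Measurable v)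
    {A B : ℝ≥0∞} (hA : A ≠ ∞) (hB : B ≠ ∞)
    (h : ∀ l : ℝ, 0 < l → μ {x | ENNReal.ofReal l < u x} ≤ A * μ {x | ENNReal.ofReal l < v x} +
      B * ((ENNReal.ofReal l ^ 2)⁻¹ * ∫⁻ x in {x | v x ≤ ENNReal.ofReal l}, v x ^ 2 ∂μ)) :
    ∫⁻ x, u x ∂μ ≤ (A + B) * ∫⁻ x, v x ∂μ := by
  have hmeas : Measurable fun p : ℝ × X => {p : ℝ × X | v p.2 ≤ ENNReal.ofReal p.1}.indicator
      (fun p => (ENNReal.ofReal p.1 ^ 2)⁻¹ * v p.2 ^ 2) p := by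
    refine Measurable.indicator (by fun_prop) ?_
    exact measurableSet_le (hv.comp measurable_snd) (ENNReal.measurable_ofReal.comp measurable_fst)
  have hrew : ∀ l : ℝ, 0 < l →
      (ENNReal.ofReal l ^ 2)⁻¹ * ∫⁻ x in {x | v x ≤ ENNReal.ofReal l}, v x ^ 2 ∂μ =
      ∫⁻ x, {p : ℝ × X | v p.2 ≤ ENNReal.ofReal p.1}.indicator
        (fun p => (ENNReal.ofReal p.1 ^ 2)⁻¹ * v p.2 ^ 2) (l, x) ∂μ := by
    intro l hl
    have hl0 : ENNReal.ofReal l ^ 2 ≠ 0 := by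
      simpa using hl
    rw [← lintegral_const_mul' _ _ (ENNReal.inv_ne_top.mpr hl0), ← lintegral_indicator
      (measurableSet_le hv measurable_const)]
    rfl
  calc ∫⁻ x, u x ∂μ = ∫⁻ l in Ioi (0 : ℝ), μ {x | ENNReal.ofReal l < u x} :=
        lintegral_eq_lintegral_Ioi_meas_lt hu
    _ ≤ ∫⁻ l in Ioi (0 : ℝ), (A * μ {x | ENNReal.ofReal l < v x} +
          B * ∫⁻ x, {p : ℝ × X | v p.2 ≤ ENNReal.ofReal p.1}.indicator
            (fun p => (ENNReal.ofReal p.1 ^ 2)⁻¹ * v p.2 ^ 2) (l, x) ∂μ) := by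
        refine setLIntegral_mono' measurableSet_Ioi fun l hl => ?_
        rw [← hrew l hl]
        exact h l hl
    _ = A * (∫⁻ l in Ioi (0 : ℝ), μ {x | ENNReal.ofReal l < v x}) +
          B * ∫⁻ l in Ioi (0 : ℝ), ∫⁻ x, {p : ℝ × X | v p.2 ≤ ENNReal.ofReal p.1}.indicator
            (fun p => (ENNReal.ofReal p.1 ^ 2)⁻¹ * v p.2 ^ 2) (l, x) ∂μ := by
        rw [lintegral_add_right, lintegral_const_mul' _ _ hA, lintegral_const_mul' _ _ hB]
        exact (hmeas.lintegral_prod_right').const_mul _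
    _ ≤ A * (∫⁻ x, v x ∂μ) + B * ∫⁻ x, v x ∂μ := by
        gcongr
        · exact (lintegral_eq_lintegral_Ioi_meas_lt hv).ge
        · rw [lintegral_lintegral_swap hmeas.aemeasurable]
          exact lintegral_mono fun x => lintegral_Ioi_inv_sq_le (v x)
    _ = _ := (add_mul _ _ _).symm

end LayerCake

/-! ### Covering by balls that a set fills at least by half -/

/-- A distance for which the balls of radius `r` have measure `c r ^ Q`. -/
structure IsHomogeneousDist {X : Type*} [MeasurableSpace X] (μ : Measure X) (d : X → X → ℝ)
    (Q : ℕ) (c : ℝ≥0∞) : Prop where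
  comm : ∀ x y, d x y = d y x
  triangle : ∀ x y z, d x z ≤ d x y + d y z
  measurable : Measurable fun p : X × X => d p.1 p.2
  ne_zero : c ≠ 0
  ne_top : c ≠ ∞
  measure_closedBall : ∀ x, ∀ r, 0 < r → μ {y | d x y ≤ r} = ENNReal.ofReal (r ^ Q) * c

namespace IsHomogeneousDist

variable {X : Type*} [MeasurableSpace X] {μ : Measure X} {d : X → X → ℝ} {Q : ℕ} {c : ℝ≥0∞}
  (hd : IsHomogeneousDist μ d Q c)

include hd

theorem measurableSet_closedBall (x : X) (r : ℝ) : MeasurableSet {y | d x y ≤ r} :=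
  measurableSet_le (hd.measurable.comp measurable_prodMk_left) measurable_const

theorem measure_closedBall_pos (x : X) {r : ℝ} (hr : 0 < r) : 0 < μ {y | d x y ≤ r} := by
  rw [hd.measure_closedBall x r hr]
  exact ENNReal.mul_pos (by simpa using pow_pos hr Q) hd.ne_zero

theorem measure_closedBall_ne_top (x : X) {r : ℝ} (hr : 0 < r) : μ {y | d x y ≤ r} ≠ ∞ := by
  rw [hd.measure_closedBall x r hr]
  exact ENNReal.mul_ne_top ENNReal.ofReal_ne_top hd.ne_top

theorem measure_closedBall_mul (x : X) {s r : ℝ} (hs : 0 < s) (hr : 0 < r) :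
    μ {y | d x y ≤ s * r} = ENNReal.ofReal (s ^ Q) * μ {y | d x y ≤ r} := by
  rw [hd.measure_closedBall x r hr, hd.measure_closedBall x _ (mul_pos hs hr), mul_pow,
    ENNReal.ofReal_mul (by positivity), mul_assoc]

/-- The measure of the union of the balls `B(h, γ t)` such that `E` fills at least half of
`B(h, β t)` is bounded by a multiple of the measure of `E`. -/
theorem measure_biUnion_closedBall_le [SFinite μ] {β γ : ℝ} (hβ : 0 < β) (hβγ : β ≤ γ)
    (E : Set X) :
    μ (⋃ p ∈ {p : X × ℝ | 0 < p.2 ∧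
        μ {y | d p.1 y ≤ β * p.2} ≤ 2 * μ ({y | d p.1 y ≤ β * p.2} ∩ E)},
      {y | d p.1 y ≤ γ * p.2}) ≤ ENNReal.ofReal (2 * (5 * γ / β) ^ Q) * μ E := by
  have hγ : 0 < γ := hβ.trans_le hβγ
  set F : Set (X × ℝ) := {p : X × ℝ | 0 < p.2 ∧
    μ {y | d p.1 y ≤ β * p.2} ≤ 2 * μ ({y | d p.1 y ≤ β * p.2} ∩ E)} with hF
  -- Vitali's lemma needs bounded radii; monotone convergence then removes the restriction `t ≤ R`.
  have bound : ∀ R : ℕ, μ (⋃ p ∈ {p ∈ F | p.2 ≤ R}, {y | d p.1 y ≤ γ * p.2}) ≤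
      ENNReal.ofReal (2 * (5 * γ / β) ^ Q) * μ E := by
    intro R
    obtain ⟨u, hut, hdisj, hcov⟩ := Vitali.exists_disjoint_subfamily_covering_enlargement
      (fun p : X × ℝ => {y | d p.1 y ≤ γ * p.2}) {p ∈ F | p.2 ≤ R} (fun p => γ * p.2) 2
      one_lt_two (fun p hp => by have := hp.1.1; positivity) (γ * R)
      (fun p hp => by have := hp.2; gcongr)
      (fun p hp => nonempty_of_measure_ne_zero
        (hd.measure_closedBall_pos p.1 (mul_pos hγ hp.1.1)).ne')
    have hucount : u.Countable := by
      have h1 := Measure.countable_meas_pos_of_disjoint_iUnion (μ := μ)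
        (As := fun p : u => {y | d p.1.1 y ≤ γ * p.1.2})
        (fun p => hd.measurableSet_closedBall _ _)
        (fun p q hpq => hdisj p.2 q.2 fun h => hpq (Subtype.ext h))
      have h2 : {p : u | 0 < μ {y | d p.1.1 y ≤ γ * p.1.2}} = univ :=
        eq_univ_of_forall fun p =>
          hd.measure_closedBall_pos p.1.1 (mul_pos hγ (hut p.2).1.1)
      rw [h2] at h1
      exact countable_univ_iff.mp h1
    -- Each ball meets a selected one of at least half its radius, so it lies in the `1 + 2 + 2 = 5`
    -- fold enlargement.
    have hsub : (⋃ p ∈ {p ∈ F | p.2 ≤ R}, {y | d p.1 y ≤ γ * p.2}) ⊆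
        ⋃ q ∈ u, {y | d q.1 y ≤ 5 * γ / β * (β * q.2)} := by
      refine iUnion₂_subset fun p hp y hy => ?_
      obtain ⟨q, hq, ⟨z, hz1, hz2⟩, hr⟩ := hcov p hp
      refine mem_iUnion₂.mpr ⟨q, hq, ?_⟩
      have e : 5 * γ / β * (β * q.2) = 5 * (γ * q.2) := by field_simp
      have h1 : d q.1 y ≤ d q.1 z + d z p.1 + d p.1 y :=
        (hd.triangle q.1 p.1 y).trans (by gcongr; exact hd.triangle _ _ _)
      rw [hd.comm z p.1] at h1
      simp only [mem_ofPred_eq] at hy hz1 hz2 ⊢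
      linarith
    calc μ (⋃ p ∈ {p ∈ F | p.2 ≤ R}, {y | d p.1 y ≤ γ * p.2})
        ≤ μ (⋃ q ∈ u, {y | d q.1 y ≤ 5 * γ / β * (β * q.2)}) := measure_mono hsub
      _ ≤ ∑' q : u, μ {y | d q.1.1 y ≤ 5 * γ / β * (β * q.1.2)} :=
          measure_biUnion_le μ hucount _
      _ ≤ ∑' q : u, ENNReal.ofReal (2 * (5 * γ / β) ^ Q) *
            μ.restrict E {y | d q.1.1 y ≤ γ * q.1.2} := by
          -- The enlarged ball is `5γ/β` times `B(h, βt)`, which `E` fills by half. Passing to the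
          -- part of `E` in the larger ball `B(h, γt)` makes the sets disjoint.
          refine ENNReal.tsum_le_tsum fun q => ?_
          have hq := (hut q.2).1
          rw [hd.measure_closedBall_mul q.1.1 (by positivity) (mul_pos hβ hq.1),
            mul_comm (2 : ℝ), ENNReal.ofReal_mul (by positivity), mul_assoc,
            Measure.restrict_apply (hd.measurableSet_closedBall _ _)]
          gcongr
          refine hq.2.trans ?_
          rw [ENNReal.ofReal_ofNat]
          gcongr
          exact hq.1.le
      _ = ENNReal.ofReal (2 * (5 * γ / β) ^ Q) *
            μ.restrict E (⋃ q ∈ u, {y | d q.1 y ≤ γ * q.2}) := by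
          rw [ENNReal.tsum_mul_left, measure_biUnion hucount hdisj
            (fun q _ => hd.measurableSet_closedBall _ _)]
      _ ≤ ENNReal.ofReal (2 * (5 * γ / β) ^ Q) * μ E := by
          exact mul_le_mul_right
            ((measure_mono (subset_univ _)).trans_eq (Measure.restrict_apply_univ E)) _
  have hunion : (⋃ p ∈ F, {y | d p.1 y ≤ γ * p.2}) =
      ⋃ R : ℕ, ⋃ p ∈ {p ∈ F | p.2 ≤ R}, {y | d p.1 y ≤ γ * p.2} := by
    ext y
    simp only [mem_iUnion, exists_prop]
    constructor
    · rintro ⟨p, hp, hy⟩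
      obtain ⟨R, hR⟩ := exists_nat_ge p.2
      exact ⟨R, p, ⟨hp, hR⟩, hy⟩
    · rintro ⟨R, p, hp, hy⟩
      exact ⟨p, hp.1, hy⟩
  rw [hunion, Monotone.measure_iUnion]
  · exact iSup_le bound
  · intro R R' hRR' y hy
    simp only [mem_iUnion, exists_prop] at hy ⊢
    obtain ⟨p, hp, hy⟩ := hy
    exact ⟨p, ⟨hp.1, hp.2.trans (by exact_mod_cast hRR')⟩, hy⟩

end IsHomogeneousDist

/-! ### Change of aperture in one parameter -/

section AreaIntegral

variable {X Y : Type*} [MeasurableSpace X] [MeasurableSpace Y] {μ : Measure X} {ν : Measure Y}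
  {d : X → X → ℝ} {Q : ℕ} {c : ℝ≥0∞} {h : Y → X} {t : Y → ℝ} {W : Y → ℝ≥0∞}

/-- The integral of `W` over the cone `{y | d x (h y) ≤ α t y}`. -/
def coneIntegral (ν : Measure Y) (d : X → X → ℝ) (h : Y → X) (t : Y → ℝ) (W : Y → ℝ≥0∞) (α : ℝ)
    (x : X) : ℝ≥0∞ :=
  ∫⁻ y, {y | d x (h y) ≤ α * t y}.indicator W y ∂ν

theorem measurable_indicator_cone (hd : IsHomogeneousDist μ d Q c) (hh : Measurable h)
    (ht : Measurable t) (hW : Measurable W) (α : ℝ) :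
    Measurable fun p : X × Y => {y | d p.1 (h y) ≤ α * t y}.indicator W p.2 := by
  have hm : MeasurableSet {p : X × Y | d p.1 (h p.2) ≤ α * t p.2} :=
    measurableSet_le (hd.measurable.comp (measurable_fst.prodMk (hh.comp measurable_snd)))
      ((ht.comp measurable_snd).const_mul α)
  exact (hW.comp measurable_snd).indicator hm

theorem measurable_coneIntegral [SFinite ν] (hd : IsHomogeneousDist μ d Q c) (hh : Measurable h)
    (ht : Measurable t) (hW : Measurable W) (α : ℝ) :
    Measurable (coneIntegral ν d h t W α) :=
  (measurable_indicator_cone hd hh ht hW α).lintegral_prod_right'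

/-- Tonelli: for fixed `y`, the vertices whose cone contains `y` form a ball about `h y`. -/
theorem setLIntegral_coneIntegral [SFinite μ] [SFinite ν] (hd : IsHomogeneousDist μ d Q c)
    (hh : Measurable h) (ht : Measurable t) (hW : Measurable W) (α : ℝ) (A : Set X) :
    ∫⁻ x in A, coneIntegral ν d h t W α x ∂μ =
      ∫⁻ y, W y * μ ({x | d (h y) x ≤ α * t y} ∩ A) ∂ν := by
  unfold coneIntegral
  rw [lintegral_lintegral_swap (measurable_indicator_cone hd hh ht hW α).aemeasurable]
  refine lintegral_congr fun y => ?_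
  have hm := hd.measurableSet_closedBall (h y) (α * t y)
  rw [← Measure.restrict_apply hm, ← lintegral_indicator_const hm]
  refine lintegral_congr fun x => ?_
  simp only [indicator, mem_ofPred_eq, hd.comm x (h y)]

/-- After Tonelli the integrands are compared for each `y`. If `B(h y, α t y)` meets `Fᶜ`, then `(h
y, t y)` is not bad, so at least half of `B(h y, β t y)` lies in `Eᶜ`; homogeneity compares the two
balls. -/
theorem setLIntegral_coneIntegral_compl_le [SFinite μ] [SFinite ν]
    (hd : IsHomogeneousDist μ d Q c) (hh : Measurable h) (ht : Measurable t) (hW : Measurable W)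
    (hpos : ∀ y, W y ≠ 0 → 0 < t y) {α β γ : ℝ} (hα : 0 < α) (hβ : 0 < β) (hαγ : α ≤ γ)
    {E F : Set X} (hE : MeasurableSet E)
    (hF : (⋃ p ∈ {p : X × ℝ | 0 < p.2 ∧
        μ {y | d p.1 y ≤ β * p.2} ≤ 2 * μ ({y | d p.1 y ≤ β * p.2} ∩ E)},
      {y | d p.1 y ≤ γ * p.2}) ⊆ F) :
    ∫⁻ x in Fᶜ, coneIntegral ν d h t W α x ∂μ ≤
      ENNReal.ofReal (2 * (α / β) ^ Q) * ∫⁻ x in Eᶜ, coneIntegral ν d h t W β x ∂μ := by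
  rw [setLIntegral_coneIntegral hd hh ht hW, setLIntegral_coneIntegral hd hh ht hW,
    ← lintegral_const_mul' _ _ ENNReal.ofReal_ne_top]
  refine lintegral_mono fun y => ?_
  simp only
  by_cases hWy : W y = 0
  · simp [hWy]
  have hty := hpos y hWy
  rw [mul_left_comm]
  gcongr
  rcases Set.eq_empty_or_nonempty ({x | d (h y) x ≤ α * t y} ∩ Fᶜ) with he | ⟨x, hx, hxF⟩
  · rw [he, measure_empty]; exact zero_le
  have hgood : 2 * μ ({z | d (h y) z ≤ β * t y} ∩ E) < μ {z | d (h y) z ≤ β * t y} := by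
    by_contra hbad
    rw [not_lt] at hbad
    exact hxF (hF (mem_iUnion₂.mpr ⟨(h y, t y), ⟨hty, hbad⟩,
      (le_trans hx (by gcongr) : d (h y) x ≤ γ * t y)⟩))
  set B := {z | d (h y) z ≤ β * t y} with hB
  have hBfin : μ B ≠ ∞ := hd.measure_closedBall_ne_top _ (mul_pos hβ hty)
  have hhalf : μ B ≤ 2 * μ (B ∩ Eᶜ) := by
    have hsplit : μ (B ∩ E) + μ (B ∩ Eᶜ) = μ B := by
      rw [← sdiff_eq]; exact measure_inter_add_sdiff B hE
    have h2 : μ B + μ B ≤ μ B + 2 * μ (B ∩ Eᶜ) := by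
      calc μ B + μ B = 2 * (μ (B ∩ E) + μ (B ∩ Eᶜ)) := by rw [hsplit, two_mul]
        _ = 2 * μ (B ∩ E) + 2 * μ (B ∩ Eᶜ) := mul_add _ _ _
        _ ≤ _ := by gcongr
    exact (ENNReal.add_le_add_iff_left hBfin).mp h2
  calc μ ({x | d (h y) x ≤ α * t y} ∩ Fᶜ) ≤ μ {x | d (h y) x ≤ α / β * (β * t y)} := by
        refine measure_mono fun z hz => ?_
        rw [mem_ofPred_eq, show α / β * (β * t y) = α * t y by field_simp]
        exact hz.1
    _ = ENNReal.ofReal ((α / β) ^ Q) * μ B :=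
        hd.measure_closedBall_mul _ (by positivity) (mul_pos hβ hty)
    _ ≤ ENNReal.ofReal ((α / β) ^ Q) * (2 * μ (B ∩ Eᶜ)) := by gcongr
    _ = ENNReal.ofReal (2 * (α / β) ^ Q) * μ (B ∩ Eᶜ) := by
        rw [mul_comm (2 : ℝ), ENNReal.ofReal_mul (by positivity), ENNReal.ofReal_ofNat, mul_assoc]

/-- Change of aperture in `L¹` for area integrals in one parameter. -/
theorem lintegral_sqrt_coneIntegral_le [SFinite μ] [SFinite ν] (hd : IsHomogeneousDist μ d Q c)
    (hh : Measurable h) (ht : Measurable t) (hW : Measurable W) (hpos : ∀ y, W y ≠ 0 → 0 < t y)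
    {α β : ℝ} (hα : 0 < α) (hβ : 0 < β) :
    ∫⁻ x, coneIntegral ν d h t W α x ^ (1 / 2 : ℝ) ∂μ ≤
      ENNReal.ofReal (4 * (5 * max α β / β) ^ Q) *
        ∫⁻ x, coneIntegral ν d h t W β x ^ (1 / 2 : ℝ) ∂μ := by
  have hmα := measurable_coneIntegral (ν := ν) hd hh ht hW α
  have hmβ := measurable_coneIntegral (ν := ν) hd hh ht hW β
  have hsq : ∀ a : ℝ≥0∞, (a ^ (1 / 2 : ℝ)) ^ 2 = a := fun a => by
    rw [← ENNReal.rpow_natCast, ← ENNReal.rpow_mul]; norm_num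
  have hconst : ENNReal.ofReal (2 * (5 * max α β / β) ^ Q) + ENNReal.ofReal (2 * (α / β) ^ Q) ≤
      ENNReal.ofReal (4 * (5 * max α β / β) ^ Q) := by
    have h1 : α / β ≤ 5 * max α β / β := by
      gcongr
      have := le_max_left α β
      linarith
    have h2 : (α / β) ^ Q ≤ (5 * max α β / β) ^ Q := by gcongr
    rw [← ENNReal.ofReal_add (by positivity) (by positivity)]
    exact ENNReal.ofReal_le_ofReal (by linarith)
  refine (lintegral_le_of_meas_lt_le (hmα.pow_const (1 / 2 : ℝ)) (hmβ.pow_const (1 / 2 : ℝ))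
    (A := ENNReal.ofReal (2 * (5 * max α β / β) ^ Q)) (B := ENNReal.ofReal (2 * (α / β) ^ Q))
    ENNReal.ofReal_ne_top ENNReal.ofReal_ne_top fun l hl => ?_).trans (by gcongr)
  set E := {x | ENNReal.ofReal l < coneIntegral ν d h t W β x ^ (1 / 2 : ℝ)} with hEdef
  have hE : MeasurableSet E := measurableSet_lt measurable_const (hmβ.pow_const _)
  set U := ⋃ p ∈ {p : X × ℝ | 0 < p.2 ∧
    μ {y | d p.1 y ≤ β * p.2} ≤ 2 * μ ({y | d p.1 y ≤ β * p.2} ∩ E)},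
    {y | d p.1 y ≤ max α β * p.2} with hU
  -- The uncountable union `U` need not be measurable; its measurable hull has the same measure.
  set F := toMeasurable μ U with hFdef
  have hFle : μ F ≤ ENNReal.ofReal (2 * (5 * max α β / β) ^ Q) * μ E := by
    rw [hFdef, measure_toMeasurable]
    exact hd.measure_biUnion_closedBall_le hβ (le_max_right α β) E
  have hEc : {x | coneIntegral ν d h t W β x ^ (1 / 2 : ℝ) ≤ ENNReal.ofReal l} = Eᶜ := by
    ext x; simp [hEdef]
  have hl0 : ENNReal.ofReal l ^ 2 ≠ 0 := by simpa using hl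
  have hltop : ENNReal.ofReal l ^ 2 ≠ ∞ := by simp
  set S := {x | ENNReal.ofReal l < coneIntegral ν d h t W α x ^ (1 / 2 : ℝ)} with hS
  -- Chebyshev's inequality in `L²`: on `S` the cone integral itself is at least `l²`.
  have hcheb : μ (S ∩ Fᶜ) ≤ (ENNReal.ofReal l ^ 2)⁻¹ *
      ∫⁻ x in Fᶜ, coneIntegral ν d h t W α x ∂μ := by
    rw [← ENNReal.div_eq_inv_mul, ENNReal.le_div_iff_mul_le (Or.inl hl0) (Or.inl hltop),
      mul_comm]
    have hSm : MeasurableSet S := measurableSet_lt measurable_const (hmα.pow_const _)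
    rw [← Measure.restrict_apply hSm]
    refine le_trans ?_ (mul_meas_ge_le_lintegral (μ := μ.restrict Fᶜ) hmα (ENNReal.ofReal l ^ 2))
    gcongr
    intro x hx
    rw [mem_ofPred_eq, ← hsq (coneIntegral ν d h t W α x)]
    exact pow_le_pow_left₀ zero_le (le_of_lt hx) 2
  calc μ S ≤ μ (F ∪ S ∩ Fᶜ) := measure_mono fun x hx => by
        by_cases hxF : x ∈ F
        · exact Or.inl hxF
        · exact Or.inr ⟨hx, hxF⟩
    _ ≤ μ F + μ (S ∩ Fᶜ) := measure_union_le _ _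
    _ ≤ _ := by
        refine add_le_add hFle (hcheb.trans ?_)
        rw [hEc, mul_left_comm]
        gcongr
        simp only [hsq]
        exact setLIntegral_coneIntegral_compl_le hd hh ht hW hpos hα hβ (le_max_left α β) hE
          (subset_toMeasurable μ U)

end AreaIntegral

/-! ### Change of aperture in two parameters -/

section ProductArea

variable {X₁ X₂ Y : Type*} [MeasurableSpace X₁] [MeasurableSpace X₂] [MeasurableSpace Y]
  {μ₁ : Measure X₁} {μ₂ : Measure X₂} {ν : Measure Y}
  {d₁ : X₁ → X₁ → ℝ} {d₂ : X₂ → X₂ → ℝ} {Q₁ Q₂ : ℕ} {c₁ c₂ : ℝ≥0∞}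
  {h₁ : Y → X₁} {h₂ : Y → X₂} {t₁ t₂ : Y → ℝ} {W : Y → ℝ≥0∞}

/-- The integral of `W` over the product of two cones. -/
def prodConeIntegral (ν : Measure Y) (d₁ : X₁ → X₁ → ℝ) (d₂ : X₂ → X₂ → ℝ) (h₁ : Y → X₁)
    (h₂ : Y → X₂) (t₁ t₂ : Y → ℝ) (W : Y → ℝ≥0∞) (α₁ α₂ : ℝ) (x : X₁ × X₂) : ℝ≥0∞ :=
  ∫⁻ y, {y | d₁ x.1 (h₁ y) ≤ α₁ * t₁ y ∧ d₂ x.2 (h₂ y) ≤ α₂ * t₂ y}.indicator W y ∂ν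

/-- With the second variable frozen, its cone condition is part of the weight. This is why the
one-parameter estimate must allow arbitrary weights. -/
theorem prodConeIntegral_eq_left {X₁ X₂ : Type*} {d₁ : X₁ → X₁ → ℝ} {d₂ : X₂ → X₂ → ℝ}
    {h₁ : Y → X₁} {h₂ : Y → X₂} (α₁ α₂ : ℝ) (x : X₁ × X₂) :
    prodConeIntegral ν d₁ d₂ h₁ h₂ t₁ t₂ W α₁ α₂ x = coneIntegral ν d₁ h₁ t₁
      ({y | d₂ x.2 (h₂ y) ≤ α₂ * t₂ y}.indicator W) α₁ x.1 := by
  simp only [prodConeIntegral, coneIntegral, indicator_indicator]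
  rfl

theorem prodConeIntegral_eq_right {X₁ X₂ : Type*} {d₁ : X₁ → X₁ → ℝ} {d₂ : X₂ → X₂ → ℝ}
    {h₁ : Y → X₁} {h₂ : Y → X₂} (α₁ α₂ : ℝ) (x : X₁ × X₂) :
    prodConeIntegral ν d₁ d₂ h₁ h₂ t₁ t₂ W α₁ α₂ x = coneIntegral ν d₂ h₂ t₂
      ({y | d₁ x.1 (h₁ y) ≤ α₁ * t₁ y}.indicator W) α₂ x.2 := by
  simp only [prodConeIntegral, coneIntegral, indicator_indicator]
  refine lintegral_congr fun y => ?_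
  congr 1
  exact inter_comm _ _

theorem measurable_indicator_closedBall {X : Type*} [MeasurableSpace X] {μ : Measure X}
    {d : X → X → ℝ} {Q : ℕ} {c : ℝ≥0∞} {h : Y → X} {t : Y → ℝ}
    (hd : IsHomogeneousDist μ d Q c) (hh : Measurable h) (ht : Measurable t) (hW : Measurable W)
    (α : ℝ) (x : X) : Measurable ({y | d x (h y) ≤ α * t y}.indicator W) :=
  (measurable_indicator_cone hd hh ht hW α).comp measurable_prodMk_left

theorem measurable_prodConeIntegral [SFinite ν] (hd₁ : IsHomogeneousDist μ₁ d₁ Q₁ c₁)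
    (hd₂ : IsHomogeneousDist μ₂ d₂ Q₂ c₂) (hh₁ : Measurable h₁) (hh₂ : Measurable h₂)
    (ht₁ : Measurable t₁) (ht₂ : Measurable t₂) (hW : Measurable W) (α₁ α₂ : ℝ) :
    Measurable (prodConeIntegral ν d₁ d₂ h₁ h₂ t₁ t₂ W α₁ α₂) := by
  have hm : MeasurableSet {p : (X₁ × X₂) × Y |
      d₁ p.1.1 (h₁ p.2) ≤ α₁ * t₁ p.2 ∧ d₂ p.1.2 (h₂ p.2) ≤ α₂ * t₂ p.2} := by
    refine (measurableSet_le ?_ ((ht₁.comp measurable_snd).const_mul α₁)).inter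
      (measurableSet_le ?_ ((ht₂.comp measurable_snd).const_mul α₂))
    · exact hd₁.measurable.comp
        ((measurable_fst.comp measurable_fst).prodMk (hh₁.comp measurable_snd))
    · exact hd₂.measurable.comp
        ((measurable_snd.comp measurable_fst).prodMk (hh₂.comp measurable_snd))
  exact ((hW.comp measurable_snd).indicator hm).lintegral_prod_right'

/-- Change of aperture in `L¹` for area integrals in two parameters. -/
theorem lintegral_sqrt_prodConeIntegral_le [SFinite μ₁] [SFinite μ₂] [SFinite ν]
    (hd₁ : IsHomogeneousDist μ₁ d₁ Q₁ c₁) (hd₂ : IsHomogeneousDist μ₂ d₂ Q₂ c₂)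
    (hh₁ : Measurable h₁) (hh₂ : Measurable h₂) (ht₁ : Measurable t₁) (ht₂ : Measurable t₂)
    (hW : Measurable W) (hpos₁ : ∀ y, W y ≠ 0 → 0 < t₁ y) (hpos₂ : ∀ y, W y ≠ 0 → 0 < t₂ y)
    {α β : ℝ} (hα : 0 < α) (hβ : 0 < β) :
    ∫⁻ x, prodConeIntegral ν d₁ d₂ h₁ h₂ t₁ t₂ W α α x ^ (1 / 2 : ℝ) ∂(μ₁.prod μ₂) ≤
      ENNReal.ofReal (4 * (5 * max α β / β) ^ Q₁) * (ENNReal.ofReal (4 * (5 * max α β / β) ^ Q₂) *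
        ∫⁻ x, prodConeIntegral ν d₁ d₂ h₁ h₂ t₁ t₂ W β β x ^ (1 / 2 : ℝ) ∂(μ₁.prod μ₂)) := by
  have hm : ∀ α₁ α₂, AEMeasurable (fun x =>
      prodConeIntegral ν d₁ d₂ h₁ h₂ t₁ t₂ W α₁ α₂ x ^ (1 / 2 : ℝ)) (μ₁.prod μ₂) := fun α₁ α₂ =>
    ((measurable_prodConeIntegral hd₁ hd₂ hh₁ hh₂ ht₁ ht₂ hW α₁ α₂).pow_const _).aemeasurable
  -- The apertures change one at a time, from `(α, α)` through `(β, α)` to `(β, β)`.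
  calc ∫⁻ x, prodConeIntegral ν d₁ d₂ h₁ h₂ t₁ t₂ W α α x ^ (1 / 2 : ℝ) ∂(μ₁.prod μ₂)
      ≤ ENNReal.ofReal (4 * (5 * max α β / β) ^ Q₁) *
        ∫⁻ x, prodConeIntegral ν d₁ d₂ h₁ h₂ t₁ t₂ W β α x ^ (1 / 2 : ℝ) ∂(μ₁.prod μ₂) := by
        rw [lintegral_prod_symm _ (hm α α), lintegral_prod_symm _ (hm β α),
          ← lintegral_const_mul' _ _ ENNReal.ofReal_ne_top]
        refine lintegral_mono fun x₂ => ?_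
        simp only [prodConeIntegral_eq_left]
        refine lintegral_sqrt_coneIntegral_le hd₁ hh₁ ht₁
          (measurable_indicator_closedBall hd₂ hh₂ ht₂ hW α x₂) (fun y hy => hpos₁ y ?_) hα hβ
        exact (indicator_apply_ne_zero.mp hy).2
    _ ≤ _ := by
        gcongr
        rw [lintegral_prod _ (hm β α), lintegral_prod _ (hm β β),
          ← lintegral_const_mul' _ _ ENNReal.ofReal_ne_top]
        refine lintegral_mono fun x₁ => ?_
        simp only [prodConeIntegral_eq_right]
        refine lintegral_sqrt_coneIntegral_le hd₂ hh₂ ht₂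
          (measurable_indicator_closedBall hd₁ hh₁ ht₁ hW β x₁) (fun y hy => hpos₂ y ?_) hα hβ
        exact (indicator_apply_ne_zero.mp hy).2

end ProductArea

/-! ### Measure-theoretic regularity of the groups and of molecules -/

section FiniteDimensional

variable (G : Type*) [AddCommGroup G] [Module ℝ G] [FiniteDimensional ℝ G]
  [TopologicalSpace G] [IsTopologicalAddGroup G] [ContinuousSMul ℝ G] [T2Space G]

theorem secondCountableTopology_of_finiteDimensional : SecondCountableTopology G :=
  (toEuclidean (E := G)).toHomeomorph.secondCountableTopology

theorem locallyCompactSpace_of_finiteDimensional : LocallyCompactSpace G :=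
  (toEuclidean (E := G)).toHomeomorph.isClosedEmbedding.locallyCompactSpace

variable {G} in
theorem sigmaFinite_of_isAddHaarMeasure [MeasurableSpace G] (μ : Measure G)
    [μ.IsAddHaarMeasure] : SigmaFinite μ := by
  have := secondCountableTopology_of_finiteDimensional G
  have := locallyCompactSpace_of_finiteDimensional G
  infer_instance

end FiniteDimensional

attribute [local irreducible] Stratification.mul Stratification.dilation

section OneGroup

variable {G : Type*} [LieRing G] [LieAlgebra ℝ G] [FiniteDimensional ℝ G]
  [TopologicalSpace G] [IsTopologicalAddGroup G] [ContinuousSMul ℝ G] [T2Space G]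
  [MeasurableSpace G] [BorelSpace G] {S : Stratification G} (ρ : HomogeneousNorm S)

theorem HomogeneousNorm.isHomogeneousDist (μ : Measure G) [μ.IsAddHaarMeasure] :
    IsHomogeneousDist μ ρ.dist S.homDim (μ {x | ρ.toFun x ≤ 1}) where
  comm := ρ.dist_comm
  triangle := ρ.dist_triangle
  measurable := by
    have := secondCountableTopology_of_finiteDimensional G
    exact ρ.continuous_dist.measurable
  ne_zero := (ρ.measure_unitClosedBall_pos μ).ne'
  ne_top := (ρ.measure_unitClosedBall_lt_top μ).ne
  measure_closedBall g _ hr := ρ.measure_closedBall μ g hr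

/-- The denominator in the smoothness condition is at least `1`, which leaves a Hölder bound of
exponent `ε` for `ρ`. Continuity serves to make the area integrand measurable. -/
theorem HomogeneousNorm.IsMolecule.continuous {G : Type*} [LieRing G] [LieAlgebra ℝ G]
    [FiniteDimensional ℝ G] [TopologicalSpace G] [IsTopologicalAddGroup G] [ContinuousSMul ℝ G]
    [T2Space G] {S : Stratification G} {ρ : HomogeneousNorm S} {ε : ℝ} (hε : 0 < ε)
    {ψ : G → ℂ} (hψ : ρ.IsMolecule ε ψ) : Continuous ψ := by
  obtain ⟨C, -, hC⟩ := hψ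
  refine continuous_iff_continuousAt.mpr fun g => ?_
  have hself : ρ.dist g g = 0 := by rw [dist, S.neg_mul_self, ρ.map_zero]
  have hlim : Filter.Tendsto (fun g' => |C| * ρ.dist g g' ^ ε) (nhds g) (nhds 0) := by
    have h1 : Continuous fun g' => ρ.dist g g' := by
      have h2 : Continuous fun g' : G => (g, g') := Continuous.prodMk_right g
      exact ρ.continuous_dist.comp h2
    have h2 : Continuous fun g' => |C| * ρ.dist g g' ^ ε :=
      continuous_const.mul (h1.rpow_const fun _ => Or.inr hε.le)
    have h3 := h2.tendsto g
    rwa [hself, Real.zero_rpow hε.ne', mul_zero] at h3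
  refine tendsto_iff_norm_sub_tendsto_zero.mpr
    (squeeze_zero (fun _ => norm_nonneg _) (fun g' => ?_) hlim)
  rw [norm_sub_rev]
  refine (hC g g').trans ?_
  have hd : 0 ≤ ρ.dist g g' ^ ε := Real.rpow_nonneg (ρ.nonneg _) _
  have hone : 1 ≤ (1 + ρ.toFun g + ρ.toFun g') ^ ((S.homDim : ℝ) + 2 * ε) := by
    refine Real.one_le_rpow ?_ (by positivity)
    have := ρ.nonneg g
    have := ρ.nonneg g'
    linarith
  calc C * (ρ.dist g g' ^ ε / (1 + ρ.toFun g + ρ.toFun g') ^ ((S.homDim : ℝ) + 2 * ε))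
      ≤ |C| * (ρ.dist g g' ^ ε / (1 + ρ.toFun g + ρ.toFun g') ^ ((S.homDim : ℝ) + 2 * ε)) := by
        refine mul_le_mul_of_nonneg_right (le_abs_self C) (div_nonneg hd (by positivity))
    _ ≤ |C| * ρ.dist g g' ^ ε :=
        mul_le_mul_of_nonneg_left (div_le_self hd hone) (abs_nonneg C)

theorem Stratification.measurable_dilate (S : Stratification G) {ψ : G → ℂ} (hψ : Continuous ψ) :
    Measurable fun p : ℝ × G => S.dilate ψ p.1 p.2 := by
  have := secondCountableTopology_of_finiteDimensional G
  unfold dilate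
  have h1 : Measurable fun p : ℝ × G => (p.1⁻¹, p.2) :=
    measurable_fst.inv.prodMk measurable_snd
  have h2 : Measurable fun p : ℝ × G => ψ (S.dilation p.1⁻¹ p.2) :=
    (hψ.comp S.continuous_dilation).measurable.comp h1
  have h3 : Measurable fun p : ℝ × G => (((p.1 ^ S.homDim)⁻¹ : ℝ) : ℂ) :=
    Complex.measurable_ofReal.comp (measurable_fst.pow_const _).inv
  exact h3.mul h2

end OneGroup

/-! ### The area function as a product cone integral -/

section TwoGroups

variable {G₁ G₂ : Type*}
    [LieRing G₁] [LieAlgebra ℝ G₁] [FiniteDimensional ℝ G₁]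
    [TopologicalSpace G₁] [IsTopologicalAddGroup G₁] [ContinuousSMul ℝ G₁] [T2Space G₁]
    [MeasurableSpace G₁] [BorelSpace G₁]
    [LieRing G₂] [LieAlgebra ℝ G₂] [FiniteDimensional ℝ G₂]
    [TopologicalSpace G₂] [IsTopologicalAddGroup G₂] [ContinuousSMul ℝ G₂] [T2Space G₂]
    [MeasurableSpace G₂] [BorelSpace G₂]
    {S₁ : Stratification G₁} {S₂ : Stratification G₂}
    (ρ₁ : HomogeneousNorm S₁) (ρ₂ : HomogeneousNorm S₂)
    (μ₁ : Measure G₁) [μ₁.IsAddHaarMeasure] (μ₂ : Measure G₂) [μ₂.IsAddHaarMeasure]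
    {ψ₁ : G₁ → ℂ} {ψ₂ : G₂ → ℂ}

theorem measurable_conv_tensorDilate (S₁ : Stratification G₁) (S₂ : Stratification G₂)
    (hψ₁ : Continuous ψ₁) (hψ₂ : Continuous ψ₂) {f : G₁ × G₂ → ℂ} (hf : Measurable f) :
    Measurable fun p : (G₁ × G₂) × (ℝ × ℝ) =>
      conv S₁ S₂ μ₁ μ₂ f (tensorDilate S₁ S₂ ψ₁ ψ₂ p.2) p.1 := by
  have := secondCountableTopology_of_finiteDimensional G₁
  have := secondCountableTopology_of_finiteDimensional G₂
  have := sigmaFinite_of_isAddHaarMeasure μ₁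
  have := sigmaFinite_of_isAddHaarMeasure μ₂
  have m₁ : Measurable fun q : ((G₁ × G₂) × (ℝ × ℝ)) × (G₁ × G₂) =>
      S₁.mul (-q.2.1) q.1.1.1 := by
    have h : Measurable fun q : ((G₁ × G₂) × (ℝ × ℝ)) × (G₁ × G₂) => (-q.2.1, q.1.1.1) := by
      fun_prop
    exact S₁.continuous_mul.measurable.comp h
  have m₂ : Measurable fun q : ((G₁ × G₂) × (ℝ × ℝ)) × (G₁ × G₂) =>
      S₂.mul (-q.2.2) q.1.1.2 := by
    have h : Measurable fun q : ((G₁ × G₂) × (ℝ × ℝ)) × (G₁ × G₂) => (-q.2.2, q.1.1.2) := by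
      fun_prop
    exact S₂.continuous_mul.measurable.comp h
  have n₁ : Measurable fun q : ((G₁ × G₂) × (ℝ × ℝ)) × (G₁ × G₂) =>
      S₁.dilate ψ₁ q.1.2.1 (S₁.mul (-q.2.1) q.1.1.1) :=
    (S₁.measurable_dilate hψ₁).comp
      ((measurable_fst.comp (measurable_snd.comp measurable_fst)).prodMk m₁)
  have n₂ : Measurable fun q : ((G₁ × G₂) × (ℝ × ℝ)) × (G₁ × G₂) =>
      S₂.dilate ψ₂ q.1.2.2 (S₂.mul (-q.2.2) q.1.1.2) :=
    (S₂.measurable_dilate hψ₂).comp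
      ((measurable_snd.comp (measurable_snd.comp measurable_fst)).prodMk m₂)
  have h : Measurable fun q : ((G₁ × G₂) × (ℝ × ℝ)) × (G₁ × G₂) =>
      f q.2 * (S₁.dilate ψ₁ q.1.2.1 (S₁.mul (-q.2.1) q.1.1.1) *
        S₂.dilate ψ₂ q.1.2.2 (S₂.mul (-q.2.2) q.1.1.2)) :=
    (hf.comp measurable_snd).mul (n₁.mul n₂)
  exact (h.stronglyMeasurable.integral_prod_right' (ν := μ₁.prod μ₂)).measurable

/-- The integrand of the area function, up to a factor that depends only on the aperture. -/
def areaWeight (ψ₁ : G₁ → ℂ) (ψ₂ : G₂ → ℂ) (f : G₁ × G₂ → ℂ)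
    (p : (G₁ × G₂) × (ℝ × ℝ)) : ℝ≥0∞ :=
  {p : (G₁ × G₂) × (ℝ × ℝ) | 0 < p.2.1 ∧ 0 < p.2.2}.indicator (fun p =>
    ‖conv S₁ S₂ μ₁ μ₂ f (tensorDilate S₁ S₂ ψ₁ ψ₂ p.2) p.1‖ₑ ^ 2 /
      (μ₁.prod μ₂) (rectangle ρ₁ ρ₂ (0, 0) p.2) / ENNReal.ofReal (p.2.1 * p.2.2)) p

theorem measure_rectangle {r : ℝ × ℝ} (h₁ : 0 < r.1) (h₂ : 0 < r.2) :
    (μ₁.prod μ₂) (rectangle ρ₁ ρ₂ (0, 0) r) =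
      ENNReal.ofReal (r.1 ^ S₁.homDim * r.2 ^ S₂.homDim) *
        (μ₁ {x | ρ₁.toFun x < 1} * μ₂ {x | ρ₂.toFun x < 1}) := by
  have := sigmaFinite_of_isAddHaarMeasure μ₁
  have := sigmaFinite_of_isAddHaarMeasure μ₂
  rw [rectangle, Measure.prod_prod, ρ₁.measure_ball_zero μ₁ h₁, ρ₂.measure_ball_zero μ₂ h₂,
    ENNReal.ofReal_mul (by positivity), mul_mul_mul_comm]

theorem measure_rectangle_mul {β : ℝ} (hβ : 0 < β) {r : ℝ × ℝ} (h₁ : 0 < r.1) (h₂ : 0 < r.2) :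
    (μ₁.prod μ₂) (rectangle ρ₁ ρ₂ (0, 0) (β * r.1, β * r.2)) =
      ENNReal.ofReal (β ^ (S₁.homDim + S₂.homDim)) *
        (μ₁.prod μ₂) (rectangle ρ₁ ρ₂ (0, 0) r) := by
  rw [measure_rectangle ρ₁ ρ₂ μ₁ μ₂ (mul_pos hβ h₁) (mul_pos hβ h₂),
    measure_rectangle ρ₁ ρ₂ μ₁ μ₂ h₁ h₂, ← mul_assoc (ENNReal.ofReal (β ^ _)),
    ← ENNReal.ofReal_mul (by positivity)]
  congr 2
  simp only
  ring

theorem measurable_areaWeight (hψ₁ : Continuous ψ₁) (hψ₂ : Continuous ψ₂) {f : G₁ × G₂ → ℂ}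
    (hf : Measurable f) : Measurable (areaWeight ρ₁ ρ₂ μ₁ μ₂ ψ₁ ψ₂ f) := by
  have hm : MeasurableSet {p : (G₁ × G₂) × (ℝ × ℝ) | 0 < p.2.1 ∧ 0 < p.2.2} :=
    (measurableSet_lt measurable_const (measurable_fst.comp measurable_snd)).inter
      (measurableSet_lt measurable_const (measurable_snd.comp measurable_snd))
  have hc := measurable_conv_tensorDilate μ₁ μ₂ S₁ S₂ hψ₁ hψ₂ hf
  have h : Measurable fun p : (G₁ × G₂) × (ℝ × ℝ) =>
      ‖conv S₁ S₂ μ₁ μ₂ f (tensorDilate S₁ S₂ ψ₁ ψ₂ p.2) p.1‖ₑ ^ 2 /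
        (ENNReal.ofReal (p.2.1 ^ S₁.homDim * p.2.2 ^ S₂.homDim) *
          (μ₁ {x | ρ₁.toFun x < 1} * μ₂ {x | ρ₂.toFun x < 1})) /
        ENNReal.ofReal (p.2.1 * p.2.2) := by
    have h1 : Measurable fun p : (G₁ × G₂) × (ℝ × ℝ) =>
      ENNReal.ofReal (p.2.1 ^ S₁.homDim * p.2.2 ^ S₂.homDim) := by fun_prop
    have h2 : Measurable fun p : (G₁ × G₂) × (ℝ × ℝ) => ENNReal.ofReal (p.2.1 * p.2.2) := by
      fun_prop
    exact ((hc.enorm.pow_const 2).div (h1.mul_const _)).div h2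
  convert h.indicator hm using 1
  refine indicator_congr fun p hp => ?_
  rw [measure_rectangle ρ₁ ρ₂ μ₁ μ₂ hp.1 hp.2]

/-- Since `|R(o, β𝐭)| = β^{Q₁+Q₂} |R(o, 𝐭)|`, the aperture leaves the weight, so that all apertures
share one weight and can be compared. -/
theorem areaFunction_eq {β : ℝ} (hβ : 0 < β) (ψ₁ : G₁ → ℂ) (ψ₂ : G₂ → ℂ) (f : G₁ × G₂ → ℂ)
    (g : G₁ × G₂) :
    areaFunction ρ₁ ρ₂ μ₁ μ₂ ψ₁ ψ₂ β f g =
      ENNReal.ofReal (β ^ (S₁.homDim + S₂.homDim))⁻¹ ^ (1 / 2 : ℝ) *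
        prodConeIntegral ((μ₁.prod μ₂).prod volume) ρ₁.dist ρ₂.dist (fun p => p.1.1)
          (fun p => p.1.2) (fun p => p.2.1) (fun p => p.2.2) (areaWeight ρ₁ ρ₂ μ₁ μ₂ ψ₁ ψ₂ f)
          β β g ^ (1 / 2 : ℝ) := by
  have := secondCountableTopology_of_finiteDimensional G₁
  have := secondCountableTopology_of_finiteDimensional G₂
  have hcone : MeasurableSet (cone ρ₁ ρ₂ β g) := by
    have ht₁ : Measurable fun p : (G₁ × G₂) × (ℝ × ℝ) => p.2.1 := by fun_prop
    have ht₂ : Measurable fun p : (G₁ × G₂) × (ℝ × ℝ) => p.2.2 := by fun_prop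
    refine (measurableSet_lt measurable_const ht₁).inter
      ((measurableSet_lt measurable_const ht₂).inter
        ((measurableSet_le ?_ (ht₁.const_mul β)).inter (measurableSet_le ?_ (ht₂.const_mul β))))
    · have h : Measurable fun p : (G₁ × G₂) × (ℝ × ℝ) => (g.1, p.1.1) := by fun_prop
      exact ρ₁.continuous_dist.measurable.comp h
    · have h : Measurable fun p : (G₁ × G₂) × (ℝ × ℝ) => (g.2, p.1.2) := by fun_prop
      exact ρ₂.continuous_dist.measurable.comp h
  have hβQ : 0 < β ^ (S₁.homDim + S₂.homDim) := by positivity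
  rw [areaFunction, ← ENNReal.mul_rpow_of_nonneg _ _ (by norm_num), prodConeIntegral,
    ← lintegral_const_mul' _ _ ENNReal.ofReal_ne_top, ← lintegral_indicator hcone]
  congr 1
  refine lintegral_congr fun p => ?_
  by_cases hp : p ∈ cone ρ₁ ρ₂ β g
  · have hp' : p ∈ {y : (G₁ × G₂) × (ℝ × ℝ) | ρ₁.dist g.1 y.1.1 ≤ β * y.2.1 ∧
        ρ₂.dist g.2 y.1.2 ≤ β * y.2.2} := hp.2.2
    have hpos : p ∈ {p : (G₁ × G₂) × (ℝ × ℝ) | 0 < p.2.1 ∧ 0 < p.2.2} := ⟨hp.1, hp.2.1⟩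
    rw [indicator_of_mem hp, indicator_of_mem hp', areaWeight, indicator_of_mem hpos,
      measure_rectangle_mul ρ₁ ρ₂ μ₁ μ₂ hβ hp.1 hp.2.1, ENNReal.ofReal_inv_of_pos hβQ,
      div_eq_mul_inv, div_eq_mul_inv, div_eq_mul_inv, div_eq_mul_inv,
      ENNReal.mul_inv (Or.inl (by simpa using hβQ)) (Or.inl ENNReal.ofReal_ne_top)]
    ring
  · rw [indicator_of_notMem hp]
    by_cases hp' : p ∈ {y : (G₁ × G₂) × (ℝ × ℝ) | ρ₁.dist g.1 y.1.1 ≤ β * y.2.1 ∧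
        ρ₂.dist g.2 y.1.2 ≤ β * y.2.2}
    -- The distance conditions alone allow `t₁ = 0` or `t₂ = 0`; the weight vanishes there.
    · have hpos : p ∉ {p : (G₁ × G₂) × (ℝ × ℝ) | 0 < p.2.1 ∧ 0 < p.2.2} := fun h =>
        hp ⟨h.1, h.2, hp'.1, hp'.2⟩
      rw [indicator_of_mem hp', areaWeight, indicator_of_notMem hpos, mul_zero]
    · rw [indicator_of_notMem hp', mul_zero]

/-- Change of aperture for the area function. -/
theorem areaNorm_le {α β : ℝ} (hα : 0 < α) (hβ : 0 < β) (hψ₁ : Continuous ψ₁)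
    (hψ₂ : Continuous ψ₂) (f : Lp ℂ 1 (μ₁.prod μ₂)) :
    areaNorm ρ₁ ρ₂ μ₁ μ₂ ψ₁ ψ₂ α f ≤
      ENNReal.ofReal (((β / α) ^ (S₁.homDim + S₂.homDim)) ^ (1 / 2 : ℝ) *
        (16 * (5 * max α β / β) ^ (S₁.homDim + S₂.homDim))) *
        areaNorm ρ₁ ρ₂ μ₁ μ₂ ψ₁ ψ₂ β f := by
  have := sigmaFinite_of_isAddHaarMeasure μ₁
  have := sigmaFinite_of_isAddHaarMeasure μ₂
  have hK : ∀ γ : ℝ, ENNReal.ofReal (γ ^ (S₁.homDim + S₂.homDim))⁻¹ ^ (1 / 2 : ℝ) ≠ ∞ := fun γ =>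
    ENNReal.rpow_ne_top_of_nonneg (by norm_num) ENNReal.ofReal_ne_top
  unfold areaNorm
  simp only [areaFunction_eq ρ₁ ρ₂ μ₁ μ₂ hα, areaFunction_eq ρ₁ ρ₂ μ₁ μ₂ hβ]
  rw [lintegral_const_mul' _ _ (hK α), lintegral_const_mul' _ _ (hK β)]
  have hmain := lintegral_sqrt_prodConeIntegral_le (ν := (μ₁.prod μ₂).prod volume)
    (ρ₁.isHomogeneousDist μ₁) (ρ₂.isHomogeneousDist μ₂)
    (h₁ := fun p : (G₁ × G₂) × (ℝ × ℝ) => p.1.1) (h₂ := fun p => p.1.2)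
    (t₁ := fun p => p.2.1) (t₂ := fun p => p.2.2) (by fun_prop) (by fun_prop) (by fun_prop)
    (by fun_prop)
    (measurable_areaWeight ρ₁ ρ₂ μ₁ μ₂ hψ₁ hψ₂ (Lp.stronglyMeasurable f).measurable)
    (fun p hp => (indicator_apply_ne_zero.mp hp).1.1)
    (fun p hp => (indicator_apply_ne_zero.mp hp).1.2) hα hβ
  have hαQ : 0 < α ^ (S₁.homDim + S₂.homDim) := by positivity
  have hβQ : 0 < β ^ (S₁.homDim + S₂.homDim) := by positivity
  have hmax : 0 < max α β := lt_max_of_lt_left hα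
  have hconst : ENNReal.ofReal (α ^ (S₁.homDim + S₂.homDim))⁻¹ ^ (1 / 2 : ℝ) *
      (ENNReal.ofReal (4 * (5 * max α β / β) ^ S₁.homDim) *
        ENNReal.ofReal (4 * (5 * max α β / β) ^ S₂.homDim)) =
      ENNReal.ofReal (((β / α) ^ (S₁.homDim + S₂.homDim)) ^ (1 / 2 : ℝ) *
        (16 * (5 * max α β / β) ^ (S₁.homDim + S₂.homDim))) *
      ENNReal.ofReal (β ^ (S₁.homDim + S₂.homDim))⁻¹ ^ (1 / 2 : ℝ) := by
    rw [ENNReal.ofReal_rpow_of_nonneg (x := (α ^ (S₁.homDim + S₂.homDim))⁻¹) (by positivity)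
        (by norm_num),
      ENNReal.ofReal_rpow_of_nonneg (x := (β ^ (S₁.homDim + S₂.homDim))⁻¹) (by positivity)
        (by norm_num),
      ← ENNReal.ofReal_mul (by positivity), ← ENNReal.ofReal_mul (by positivity),
      ← ENNReal.ofReal_mul (by positivity)]
    congr 1
    rw [div_pow β α, div_eq_mul_inv (β ^ _) (α ^ _), Real.mul_rpow hβQ.le (by positivity)]
    have h1 : (β ^ (S₁.homDim + S₂.homDim)) ^ (1 / 2 : ℝ) *
        ((β ^ (S₁.homDim + S₂.homDim))⁻¹) ^ (1 / 2 : ℝ) = 1 := by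
      rw [← Real.mul_rpow hβQ.le (by positivity), mul_inv_cancel₀ hβQ.ne', Real.one_rpow]
    rw [pow_add (5 * max α β / β)]
    linear_combination (-16 * (5 * max α β / β) ^ S₁.homDim * (5 * max α β / β) ^ S₂.homDim *
      ((α ^ (S₁.homDim + S₂.homDim))⁻¹) ^ (1 / 2 : ℝ)) * h1
  refine (mul_le_mul_right hmain _).trans_eq ?_
  rw [← mul_assoc (ENNReal.ofReal (4 * _)), ← mul_assoc, hconst, mul_assoc]

end TwoGroups

end

end ProductHardy

/-! ### Equality of the spaces and comparison of the norms -/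

open ProductHardy
theorem proposition3p2 {G₁ G₂ : Type*}
    [LieRing G₁] [LieAlgebra ℝ G₁] [FiniteDimensional ℝ G₁]
    [TopologicalSpace G₁] [IsTopologicalAddGroup G₁] [ContinuousSMul ℝ G₁] [T2Space G₁]
    [MeasurableSpace G₁] [BorelSpace G₁]
    [LieRing G₂] [LieAlgebra ℝ G₂] [FiniteDimensional ℝ G₂]
    [TopologicalSpace G₂] [IsTopologicalAddGroup G₂] [ContinuousSMul ℝ G₂] [T2Space G₂]
    [MeasurableSpace G₂] [BorelSpace G₂]
    (S₁ : Stratification G₁) (S₂ : Stratification G₂)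
    (ρ₁ : HomogeneousNorm S₁) (ρ₂ : HomogeneousNorm S₂)
    (μ₁ : Measure G₁) [μ₁.IsAddHaarMeasure] (μ₂ : Measure G₂) [μ₂.IsAddHaarMeasure]
    (ε : ℝ) (hε : 0 < ε) (hε' : ε ≤ 1) :
    -- the spaces coincide
    (∀ ψ₁ ψ₂, ρ₁.IsCancellingMolecule μ₁ ε ψ₁ → ρ₂.IsCancellingMolecule μ₂ ε ψ₂ →
      ∀ β : ℝ, 0 < β →
        hardySpace ρ₁ ρ₂ μ₁ μ₂ ψ₁ ψ₂ β = hardySpace ρ₁ ρ₂ μ₁ μ₂ ψ₁ ψ₂ 1) ∧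
    -- their norms are equivalent
    (∀ β : ℝ, 0 < β → ∃ c C : ℝ, 0 < c ∧ 0 < C ∧
      ∀ ψ₁ ψ₂, ρ₁.IsCancellingMolecule μ₁ ε ψ₁ → ρ₂.IsCancellingMolecule μ₂ ε ψ₂ →
        ∀ f : Lp ℂ 1 (μ₁.prod μ₂),
          ENNReal.ofReal c * areaNorm ρ₁ ρ₂ μ₁ μ₂ ψ₁ ψ₂ 1 f
              ≤ areaNorm ρ₁ ρ₂ μ₁ μ₂ ψ₁ ψ₂ β f ∧
          areaNorm ρ₁ ρ₂ μ₁ μ₂ ψ₁ ψ₂ β f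
              ≤ ENNReal.ofReal C * areaNorm ρ₁ ρ₂ μ₁ μ₂ ψ₁ ψ₂ 1 f) ∧
    -- the quantitative bound for large apertures, with a constant that does not depend on `β`
    (∃ C : ℝ, 0 < C ∧
      ∀ ψ₁ ψ₂, ρ₁.IsCancellingMolecule μ₁ ε ψ₁ → ρ₂.IsCancellingMolecule μ₂ ε ψ₂ →
        ∀ β : ℝ, 1 ≤ β → ∀ f : Lp ℂ 1 (μ₁.prod μ₂),
          areaNorm ρ₁ ρ₂ μ₁ μ₂ ψ₁ ψ₂ β f
            ≤ ENNReal.ofReal (C * β ^ (S₁.homDim + S₂.homDim) * (1 + Real.posLog β)) *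
              areaNorm ρ₁ ρ₂ μ₁ μ₂ ψ₁ ψ₂ 1 f) := by
  refine ⟨fun ψ₁ ψ₂ h₁ h₂ β hβ => ?_, fun β hβ => ?_, ?_⟩
  · have hψ₁ := h₁.1.continuous hε
    have hψ₂ := h₂.1.continuous hε
    ext f
    exact ⟨fun hf => (areaNorm_le ρ₁ ρ₂ μ₁ μ₂ one_pos hβ hψ₁ hψ₂ f).trans_lt
        (ENNReal.mul_lt_top ENNReal.ofReal_lt_top hf),
      fun hf => (areaNorm_le ρ₁ ρ₂ μ₁ μ₂ hβ one_pos hψ₁ hψ₂ f).trans_lt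
        (ENNReal.mul_lt_top ENNReal.ofReal_lt_top hf)⟩
  · have hmax : 0 < max 1 β := lt_max_of_lt_left one_pos
    have hmax' : 0 < max β 1 := lt_max_of_lt_left hβ
    -- The lower constant is the reciprocal of the one for passing from aperture `1` to `β`; the
    -- upper one is for passing from `β` to `1`.
    refine ⟨(((β / 1) ^ (S₁.homDim + S₂.homDim)) ^ (1 / 2 : ℝ) *
        (16 * (5 * max 1 β / β) ^ (S₁.homDim + S₂.homDim)))⁻¹,
      ((1 / β) ^ (S₁.homDim + S₂.homDim)) ^ (1 / 2 : ℝ) *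
        (16 * (5 * max β 1 / 1) ^ (S₁.homDim + S₂.homDim)), by positivity, by positivity,
      fun ψ₁ ψ₂ h₁ h₂ f => ⟨?_, ?_⟩⟩
    · have hC : 0 < ((β / 1) ^ (S₁.homDim + S₂.homDim)) ^ (1 / 2 : ℝ) *
        (16 * (5 * max 1 β / β) ^ (S₁.homDim + S₂.homDim)) := by positivity
      rw [ENNReal.ofReal_inv_of_pos hC, mul_comm, ← div_eq_mul_inv]
      refine ENNReal.div_le_of_le_mul' ?_
      exact areaNorm_le ρ₁ ρ₂ μ₁ μ₂ one_pos hβ (h₁.1.continuous hε) (h₂.1.continuous hε) f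
    · exact areaNorm_le ρ₁ ρ₂ μ₁ μ₂ hβ one_pos (h₁.1.continuous hε) (h₂.1.continuous hε) f
  · refine ⟨16 * 5 ^ (S₁.homDim + S₂.homDim), by positivity, fun ψ₁ ψ₂ h₁ h₂ β hβ f => ?_⟩
    have hβ0 : 0 < β := one_pos.trans_le hβ
    refine (areaNorm_le ρ₁ ρ₂ μ₁ μ₂ hβ0 one_pos (h₁.1.continuous hε)
      (h₂.1.continuous hε) f).trans ?_
    refine mul_le_mul' (ENNReal.ofReal_le_ofReal ?_) le_rfl
    -- The normalising factor `β^{-(Q₁+Q₂)/2}` is discarded, and `1 + log⁺ β ≥ 1` is simply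
    -- inserted: the argument produces no logarithm.
    have hle : ((1 / β) ^ (S₁.homDim + S₂.homDim)) ^ (1 / 2 : ℝ) ≤ 1 :=
      Real.rpow_le_one (by positivity)
        (pow_le_one₀ (by positivity) ((div_le_one hβ0).mpr hβ)) (by norm_num)
    rw [max_eq_left hβ, div_one, mul_pow, mul_assoc (16 : ℝ)]
    calc _ ≤ 1 * (16 * (5 ^ (S₁.homDim + S₂.homDim) * β ^ (S₁.homDim + S₂.homDim))) := by gcongr
      _ = (16 * (5 ^ (S₁.homDim + S₂.homDim) * β ^ (S₁.homDim + S₂.homDim))) * 1 := by ring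
      _ ≤ _ := by
        rw [← mul_assoc (16 : ℝ)]
        gcongr
        have := Real.posLog_nonneg (x := β)
        linarith
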